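/- **Theorem.** Let $\Bbbk$ be a field of characteristic zero and let all gradings be by $\mathbb Z$. *Conventions.* For $\sigma\in\mathbb S_n$ and homogeneous $v_1,\dots,v_n$ put $\hat\sigma(v_1\otimes\cdots\otimes v_n)=v_{\sigma(1)}\otimes\cdots\otimes v_{\sigma(n)}$, let $\varepsilon(\sigma)\in\{\pm1\}$ be the Koszul sign, determined by $v_1\wedge\cdots\wedge v_n=\varepsilon(\sigma)\,v_{\sigma(1)}\wedge\cdots\wedge v_{\sigma(n)}$ in the free graded commutative algebra, let $\chi(\sigma)=\operatorname{sgn}(\sigma)\varepsilon(\sigma)$, and for $1\le t<n$ let $\kappa(\sigma)_t=(-1)^{(t-1)+(n-t-1)\sum_{p=1}^t|v_{\sigma(p)}|}$. Let $\mathbb S_{t,n-t}$ be the set of $\sigma\in\mathbb S_n$ with $\sigma(1)<\cdots<\sigma(t)$ and $\sigma(t+1)<\cdots<\sigma(n)$, and for $1\le t<n$ let $\mathbb S^-_{t,n-t}$ be the set of those $\sigma \in \mathbb S_{t,n-t}$ with $\sigma(1)<\sigma(t+1)$. A linear map $m$ on $\otimes^nV$ is skew symmetric if $m\hat\sigma=\chi(\sigma)m$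 for all $\sigma\in\mathbb S_n$. All identities below between maps on $\otimes^n V$ are meant on homogeneous elements $v_1\otimes\cdots\otimes v_n$. An *$L_\infty$-structure* on a graded vector space $L$ is a family of skew symmetric linear maps $l_n:\otimes^nL\to L$ $(n\ge1)$ of degree $2-n$ such that for every $n\ge1$ $$\sum_{i+j=n+1}\ \sum_{\sigma\in\mathbb S_{i,n-i}}(-1)^{i(j-1)}\chi(\sigma)\,l_j(l_i\otimes\mathrm{Id}^{\otimes n-i})\hat\sigma=0 .$$ A *weak $L_\infty$-morphism* from $(L,l_n)$ to a dg-Lie algebra $(C,d,[-,-])$ is a family of skew symmetric linear maps $\phi_n:\otimes^nL\to C$ $(n\ge1)$ of degree $1-n$ such that for every $n\ge1$ $$d\phi_n+\sum_{j+k=n+1}\ \sum_{\sigma\in\mathbb S_{k,n-k}}\chi(\sigma)(-1)^{k(j-1)+1}\phi_j(l_k\otimes\mathrm{Id}^{\otimes n-k})\hat\sigma+\sum_{s+t=n}\ \sum_{\tau\in\mathbb S^-_{s,n-s}}\chi(\tau)\kappa(\tau)_s[\phi_s,\phi_t]\hat\tau=0 .$$ Here $i,j,k,s,t\ge1$, and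 $[\phi_s,\phi_t](v_1\otimes\cdots\otimes v_n)=[\phi_s(v_1\otimes\cdots\otimes v_s),\phi_t(v_{s+1}\otimes\cdots\otimes v_n)]$. *Statement.* Let $C=(C,d,[-,-])$ be a dg-Lie algebra and $B=(B,\delta)$ a cochain complex over $\Bbbk$ (both differentials of degree $+1$). Let $G:B\to C$ and $F:C\to B$ be morphisms of complexes and $H:C\to C$ a linear map of degree $-1$ with $$FG=\mathrm{Id},\qquad GF-\mathrm{Id}=Hd+dH,\qquad FH=0 .$$ Define linear maps $l_n:\otimes^nB\to B$ and $u_n,v_n,\phi_n:\otimes^nB\to C$ recursively by $l_1=\delta$, $u_1=v_1=0$, $\phi_1=G$ and, for $n\ge2$, $$v_n=\sum_{t=1}^{n-1}\ \sum_{\tau\in\mathbb S^-_{t,n-t}}\chi(\tau)\kappa(\tau)_t[\phi_t,\phi_{n-t}]\hat\tau,\qquad l_n=Fv_n,$$ $$u_n=\sum_{k=2}^{n}\ \sum_{\tau\in\mathbb S_{k,n-k}}(-1)^{k(n-k)+1}\chi(\tau)\,\phi_{n-k+1}(l_k\otimes\mathrm{Id}^{\otimes n-k})\hat\tau,\qquad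 \phi_n=H(u_n+v_n).$$ Then the maps $l_n$, $n\ge1$, give $B$ an $L_\infty$-structure, with $l_1=\delta$. Moreover $\phi=(\phi_n)_{n\ge1}$ is a weak $L_\infty$-morphism from this $L_\infty$-algebra $B$ to $C$ that extends $G$, that is, $\phi_1=G$. -/

import Mathlib

open scoped BigOperators

namespace LInfTransfer

/-! ### Graded complexes, dg-Lie algebras, contractions

A `ℤ`-graded vector space is a vector space `V` with a family `𝓥 : ℤ → Submodule 𝕜 V` such that
`V` is the (internal) direct sum of the `𝓥 i`; the elements of `𝓥 i` are homogeneous of degree `i`. -/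

/-- A cochain complex structure on a `ℤ`-graded vector space. -/
structure CochainStructure {𝕜 V : Type*} [Field 𝕜] [AddCommGroup V] [Module 𝕜 V]
    (𝓥 : ℤ → Submodule 𝕜 V) where
  /-- the differential -/
  d : V →ₗ[𝕜] V
  d_mem : ∀ (i : ℤ) (x : V), x ∈ 𝓥 i → d x ∈ 𝓥 (i + 1)
  d_d : ∀ x : V, d (d x) = 0

/-- A dg-Lie algebra structure on a `ℤ`-graded vector space. -/
structure DGLieStructure {𝕜 V : Type*} [Field 𝕜] [AddCommGroup V] [Module 𝕜 V]
    (𝓥 : ℤ → Submodule 𝕜 V) extends CochainStructure 𝓥 where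
  /-- the bracket `[x, y]` -/
  bracket : V →ₗ[𝕜] V →ₗ[𝕜] V
  bracket_mem : ∀ (i j : ℤ) (x y : V), x ∈ 𝓥 i → y ∈ 𝓥 j → bracket x y ∈ 𝓥 (i + j)
  bracket_skew : ∀ (i j : ℤ) (x y : V), x ∈ 𝓥 i → y ∈ 𝓥 j →
    bracket x y = - ((i * j).negOnePow • bracket y x)
  leibniz : ∀ (i j : ℤ) (x y : V), x ∈ 𝓥 i → y ∈ 𝓥 j →
    d (bracket x y) = bracket (d x) y + i.negOnePow • bracket x (d y)
  jacobi : ∀ (i j k : ℤ) (x y z : V), x ∈ 𝓥 i → y ∈ 𝓥 j → z ∈ 𝓥 k →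
    bracket (bracket x y) z + (i * (j + k)).negOnePow • bracket (bracket y z) x
      - (j * k).negOnePow • bracket (bracket x z) y = 0

/-- Chain maps `G : B → C` and `F : C → B` together with a map `H : C → C` of degree `-1` such
that `F G = Id`, `G F - Id = H d + d H` and `F H = 0`. -/
structure Contraction {𝕜 B C : Type*} [Field 𝕜] [AddCommGroup B] [Module 𝕜 B]
    [AddCommGroup C] [Module 𝕜 C] {𝓑 : ℤ → Submodule 𝕜 B} {𝓒 : ℤ → Submodule 𝕜 C}
    (X : CochainStructure 𝓑) (Y : CochainStructure 𝓒) where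
  G : B →ₗ[𝕜] C
  F : C →ₗ[𝕜] B
  H : C →ₗ[𝕜] C
  G_mem : ∀ (i : ℤ) (x : B), x ∈ 𝓑 i → G x ∈ 𝓒 i
  F_mem : ∀ (i : ℤ) (y : C), y ∈ 𝓒 i → F y ∈ 𝓑 i
  H_mem : ∀ (i : ℤ) (y : C), y ∈ 𝓒 i → H y ∈ 𝓒 (i - 1)
  G_comm : ∀ x : B, Y.d (G x) = G (X.d x)
  F_comm : ∀ y : C, X.d (F y) = F (Y.d y)
  F_G : ∀ x : B, F (G x) = x
  homotopy : ∀ y : C, G (F y) - y = H (Y.d y) + Y.d (H y)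
  F_H : ∀ y : C, F (H y) = 0

/-! ### Unshuffles and signs

Positions are numbered from `0`: the usual position `p ∈ {1, …, n}` is `p - 1` here. -/

/-- The `(t, n-t)`-unshuffles: the permutations that increase on the first `t` positions and
increase on the last `n - t` positions. -/
def unshuffles (n t : ℕ) : Finset (Equiv.Perm (Fin n)) :=
  {σ | (∀ i j : Fin n, i < j → j.val < t → σ i < σ j) ∧
    (∀ i j : Fin n, t ≤ i.val → i < j → σ i < σ j)}

/-- The unshuffles `σ` with `σ(1) < σ(t+1)` (for `1 ≤ t < n`). -/
def unshufflesMinus (n t : ℕ) : Finset (Equiv.Perm (Fin n)) :=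
  {σ ∈ unshuffles n t | ∀ i j : Fin n, i.val = 0 → j.val = t → σ i < σ j}

/-- The Koszul sign `ε(σ; v₁, …, vₙ)`, where `d i` is the degree of `v i`: a factor
`(-1)^{|v_a| |v_b|}` for every pair `a < b` that `σ` puts in the opposite order, so that
`v₁ ∧ ⋯ ∧ vₙ = ε(σ) v_{σ(1)} ∧ ⋯ ∧ v_{σ(n)}` in the free graded commutative algebra. -/
def koszulSign {n : ℕ} (σ : Equiv.Perm (Fin n)) (d : Fin n → ℤ) : ℤˣ :=
  ∏ p : Fin n × Fin n with p.1 < p.2 ∧ σ p.2 < σ p.1, (d (σ p.1) * d (σ p.2)).negOnePow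

/-- The antisymmetric Koszul sign `χ(σ) = sgn(σ) ε(σ)`. -/
def chi {n : ℕ} (σ : Equiv.Perm (Fin n)) (d : Fin n → ℤ) : ℤˣ :=
  Equiv.Perm.sign σ * koszulSign σ d

/-- `κ(σ)_t = (-1)^{(t-1) + (n-t-1)(|v_{σ(1)}| + ⋯ + |v_{σ(t)}|)}`. -/
def kappa {n : ℕ} (σ : Equiv.Perm (Fin n)) (t : ℕ) (d : Fin n → ℤ) : ℤˣ :=
  (((t : ℤ) - 1) + ((n : ℤ) - t - 1) * ∑ p : Fin n with p.val < t, d (σ p)).negOnePow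

/-! ### Multilinear maps

A linear map `V^{⊗n} → W` is a multilinear map in `n` variables. -/

/-- The first `t` of `n` positions. -/
def firstIdx {n t : ℕ} (ht : t ≤ n) (i : Fin t) : Fin n := ⟨i.val, i.isLt.trans_le ht⟩

/-- The last `n - t` of `n` positions. -/
def lastIdx {n : ℕ} (t : ℕ) (i : Fin (n - t)) : Fin n := ⟨t + i.val, by omega⟩

theorem firstIdx_injective {n t : ℕ} (ht : t ≤ n) : Function.Injective (firstIdx ht) := by
  intro i j h
  simpa [firstIdx, Fin.ext_iff] using h

theorem lastIdx_injective {n t : ℕ} : Function.Injective (lastIdx (n := n) t) := by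
  intro i j h
  simpa [lastIdx, Fin.ext_iff] using h

theorem firstIdx_ne_lastIdx {n t : ℕ} (ht : t ≤ n) (i : Fin t) (j : Fin (n - t)) :
    firstIdx ht i ≠ lastIdx t j := by
  intro h
  have := congrArg Fin.val h
  simp only [firstIdx, lastIdx] at this
  omega

theorem exists_idx {n t : ℕ} (ht : t ≤ n) (a : Fin n) :
    (∃ i, a = firstIdx ht i) ∨ ∃ j, a = lastIdx t j := by
  by_cases h : a.val < t
  · exact Or.inl ⟨⟨a.val, h⟩, rfl⟩
  · exact Or.inr ⟨⟨a.val - t, by omega⟩, by ext; simp only [lastIdx]; omega⟩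

section Multilinear

variable {𝕜 B W : Type*} [Field 𝕜] [AddCommGroup B] [Module 𝕜 B] [AddCommGroup W] [Module 𝕜 W]

/-- The multilinear map whose restriction to `𝓑 (d 1) × ⋯ × 𝓑 (d n)` is the restriction of `m d`,
for all degrees `d`: a multilinear map is determined by its values on homogeneous elements, and
these can be prescribed, multilinearly, for each choice of degrees. -/
noncomputable def ofHomogeneous (𝓑 : ℤ → Submodule 𝕜 B) [DirectSum.Decomposition 𝓑] {n : ℕ}
    (m : (Fin n → ℤ) → MultilinearMap 𝕜 (fun _ : Fin n => B) W) :
    MultilinearMap 𝕜 (fun _ : Fin n => B) W :=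
  (MultilinearMap.fromDFinsuppEquiv (M := fun (_ : Fin n) (i : ℤ) => 𝓑 i) (fun _ => ℤ) 𝕜
    (fun d => (m d).compLinearMap (fun i => (𝓑 (d i)).subtype))).compLinearMap
      (fun _ => (DirectSum.decomposeLinearEquiv 𝓑).toLinearMap)

theorem ofHomogeneous_apply (𝓑 : ℤ → Submodule 𝕜 B) [DirectSum.Decomposition 𝓑] {n : ℕ}
    (m : (Fin n → ℤ) → MultilinearMap 𝕜 (fun _ : Fin n => B) W)
    (d : Fin n → ℤ) (f : Fin n → B) (hf : ∀ i, f i ∈ 𝓑 (d i)) :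
    ofHomogeneous 𝓑 m f = m d f := by
  have h : (fun i => (DirectSum.decomposeLinearEquiv 𝓑) (f i)) =
      fun i => DFinsupp.single (β := fun i : ℤ => 𝓑 i) (d i) ⟨f i, hf i⟩ := by
    funext i
    exact DirectSum.decompose_of_mem 𝓑 (hf i)
  have h2 := MultilinearMap.fromDFinsuppEquiv_single (M := fun (_ : Fin n) (i : ℤ) => 𝓑 i)
    (κ := fun _ => ℤ) (R := 𝕜)
    (f := fun d => (m d).compLinearMap (fun i => (𝓑 (d i)).subtype))
    (p := d) (x := fun i => (⟨f i, hf i⟩ : 𝓑 (d i)))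
  unfold ofHomogeneous
  rw [MultilinearMap.compLinearMap_apply]
  refine (congrArg _ h).trans (h2.trans ?_)
  rfl

/-- `[a, b] σ̂`, that is
`(v₁, …, vₙ) ↦ [a(v_{σ(1)}, …, v_{σ(t)}), b(v_{σ(t+1)}, …, v_{σ(n)})]`. -/
def bracketPerm {C : Type*} [AddCommGroup C] [Module 𝕜 C] (br : C →ₗ[𝕜] C →ₗ[𝕜] C)
    {n t : ℕ} (ht : t ≤ n) (a : MultilinearMap 𝕜 (fun _ : Fin t => B) C)
    (b : MultilinearMap 𝕜 (fun _ : Fin (n - t) => B) C) (σ : Equiv.Perm (Fin n)) :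
    MultilinearMap 𝕜 (fun _ : Fin n => B) C where
  toFun v := br (a fun i => v (σ (firstIdx ht i))) (b fun i => v (σ (lastIdx t i)))
  map_update_add' := by
    intro dec v j x y
    obtain rfl : dec = instDecidableEqFin n := Subsingleton.elim _ _
    obtain ⟨a', rfl⟩ := σ.surjective j
    rcases exists_idx ht a' with ⟨i, rfl⟩ | ⟨i, rfl⟩
    · have e1 : ∀ z : B, (fun k => Function.update v (σ (firstIdx ht i)) z (σ (firstIdx ht k))) =
          Function.update (fun k => v (σ (firstIdx ht k))) i z := fun z =>
        Function.update_comp_eq_of_injective' v (σ.injective.comp (firstIdx_injective ht)) i z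
      have e2 : ∀ z : B, (fun k => Function.update v (σ (firstIdx ht i)) z (σ (lastIdx t k))) =
          fun k => v (σ (lastIdx t k)) := fun z =>
        Function.update_comp_eq_of_forall_ne' v z
          (fun k h => firstIdx_ne_lastIdx ht i k (σ.injective h).symm)
      simp only [e1, e2, MultilinearMap.map_update_add, map_add, LinearMap.add_apply]
    · have e1 : ∀ z : B, (fun k => Function.update v (σ (lastIdx t i)) z (σ (lastIdx t k))) =
          Function.update (fun k => v (σ (lastIdx t k))) i z := fun z =>
        Function.update_comp_eq_of_injective' v (σ.injective.comp lastIdx_injective) i z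
      have e2 : ∀ z : B, (fun k => Function.update v (σ (lastIdx t i)) z (σ (firstIdx ht k))) =
          fun k => v (σ (firstIdx ht k)) := fun z =>
        Function.update_comp_eq_of_forall_ne' v z
          (fun k h => firstIdx_ne_lastIdx ht k i (σ.injective h))
      simp only [e1, e2, MultilinearMap.map_update_add, map_add]
  map_update_smul' := by
    intro dec v j c x
    obtain rfl : dec = instDecidableEqFin n := Subsingleton.elim _ _
    obtain ⟨a', rfl⟩ := σ.surjective j
    rcases exists_idx ht a' with ⟨i, rfl⟩ | ⟨i, rfl⟩
    · have e1 : ∀ z : B, (fun k => Function.update v (σ (firstIdx ht i)) z (σ (firstIdx ht k))) =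
          Function.update (fun k => v (σ (firstIdx ht k))) i z := fun z =>
        Function.update_comp_eq_of_injective' v (σ.injective.comp (firstIdx_injective ht)) i z
      have e2 : ∀ z : B, (fun k => Function.update v (σ (firstIdx ht i)) z (σ (lastIdx t k))) =
          fun k => v (σ (lastIdx t k)) := fun z =>
        Function.update_comp_eq_of_forall_ne' v z
          (fun k h => firstIdx_ne_lastIdx ht i k (σ.injective h).symm)
      simp only [e1, e2, MultilinearMap.map_update_smul, map_smul, LinearMap.smul_apply]
    · have e1 : ∀ z : B, (fun k => Function.update v (σ (lastIdx t i)) z (σ (lastIdx t k))) =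
          Function.update (fun k => v (σ (lastIdx t k))) i z := fun z =>
        Function.update_comp_eq_of_injective' v (σ.injective.comp lastIdx_injective) i z
      have e2 : ∀ z : B, (fun k => Function.update v (σ (lastIdx t i)) z (σ (firstIdx ht k))) =
          fun k => v (σ (firstIdx ht k)) := fun z =>
        Function.update_comp_eq_of_forall_ne' v z
          (fun k h => firstIdx_ne_lastIdx ht k i (σ.injective h))
      simp only [e1, e2, MultilinearMap.map_update_smul, map_smul]

/-- `p (q ⊗ Id^{⊗(n-k)}) σ̂`, that is
`(v₁, …, vₙ) ↦ p(q(v_{σ(1)}, …, v_{σ(k)}), v_{σ(k+1)}, …, v_{σ(n)})`. -/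
def insertPerm {n k : ℕ} (hk : k ≤ n) (p : MultilinearMap 𝕜 (fun _ : Fin (n - k + 1) => B) W)
    (q : MultilinearMap 𝕜 (fun _ : Fin k => B) B) (σ : Equiv.Perm (Fin n)) :
    MultilinearMap 𝕜 (fun _ : Fin n => B) W where
  toFun v := p (Fin.cons (q fun i => v (σ (firstIdx hk i))) fun i => v (σ (lastIdx k i)))
  map_update_add' := by
    intro dec v j x y
    obtain rfl : dec = instDecidableEqFin n := Subsingleton.elim _ _
    obtain ⟨a', rfl⟩ := σ.surjective j
    rcases exists_idx hk a' with ⟨i, rfl⟩ | ⟨i, rfl⟩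
    · have e1 : ∀ z : B, (fun l => Function.update v (σ (firstIdx hk i)) z (σ (firstIdx hk l))) =
          Function.update (fun l => v (σ (firstIdx hk l))) i z := fun z =>
        Function.update_comp_eq_of_injective' v (σ.injective.comp (firstIdx_injective hk)) i z
      have e2 : ∀ z : B, (fun l => Function.update v (σ (firstIdx hk i)) z (σ (lastIdx k l))) =
          fun l => v (σ (lastIdx k l)) := fun z =>
        Function.update_comp_eq_of_forall_ne' v z
          (fun l h => firstIdx_ne_lastIdx hk i l (σ.injective h).symm)
      simp only [e1, e2, MultilinearMap.map_update_add, MultilinearMap.cons_add]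
    · have e1 : ∀ z : B, (fun l => Function.update v (σ (lastIdx k i)) z (σ (lastIdx k l))) =
          Function.update (fun l => v (σ (lastIdx k l))) i z := fun z =>
        Function.update_comp_eq_of_injective' v (σ.injective.comp lastIdx_injective) i z
      have e2 : ∀ z : B, (fun l => Function.update v (σ (lastIdx k i)) z (σ (firstIdx hk l))) =
          fun l => v (σ (firstIdx hk l)) := fun z =>
        Function.update_comp_eq_of_forall_ne' v z
          (fun l h => firstIdx_ne_lastIdx hk l i (σ.injective h))
      simp only [e1, e2, Fin.cons_update, MultilinearMap.map_update_add]
  map_update_smul' := by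
    intro dec v j c x
    obtain rfl : dec = instDecidableEqFin n := Subsingleton.elim _ _
    obtain ⟨a', rfl⟩ := σ.surjective j
    rcases exists_idx hk a' with ⟨i, rfl⟩ | ⟨i, rfl⟩
    · have e1 : ∀ z : B, (fun l => Function.update v (σ (firstIdx hk i)) z (σ (firstIdx hk l))) =
          Function.update (fun l => v (σ (firstIdx hk l))) i z := fun z =>
        Function.update_comp_eq_of_injective' v (σ.injective.comp (firstIdx_injective hk)) i z
      have e2 : ∀ z : B, (fun l => Function.update v (σ (firstIdx hk i)) z (σ (lastIdx k l))) =
          fun l => v (σ (lastIdx k l)) := fun z =>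
        Function.update_comp_eq_of_forall_ne' v z
          (fun l h => firstIdx_ne_lastIdx hk i l (σ.injective h).symm)
      simp only [e1, e2, MultilinearMap.map_update_smul, MultilinearMap.cons_smul]
    · have e1 : ∀ z : B, (fun l => Function.update v (σ (lastIdx k i)) z (σ (lastIdx k l))) =
          Function.update (fun l => v (σ (lastIdx k l))) i z := fun z =>
        Function.update_comp_eq_of_injective' v (σ.injective.comp lastIdx_injective) i z
      have e2 : ∀ z : B, (fun l => Function.update v (σ (lastIdx k i)) z (σ (firstIdx hk l))) =
          fun l => v (σ (firstIdx hk l)) := fun z =>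
        Function.update_comp_eq_of_forall_ne' v z
          (fun l h => firstIdx_ne_lastIdx hk l i (σ.injective h))
      simp only [e1, e2, Fin.cons_update, MultilinearMap.map_update_smul]

/-- `m` is homogeneous of degree `e`. -/
def HasDegree (𝓑 : ℤ → Submodule 𝕜 B) (𝓦 : ℤ → Submodule 𝕜 W) {n : ℕ}
    (m : MultilinearMap 𝕜 (fun _ : Fin n => B) W) (e : ℤ) : Prop :=
  ∀ (d : Fin n → ℤ) (v : Fin n → B), (∀ i, v i ∈ 𝓑 (d i)) → m v ∈ 𝓦 ((∑ i, d i) + e)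

/-- `m` is skew symmetric: `m σ̂ = χ(σ) m` for all `σ`. -/
def IsSkew (𝓑 : ℤ → Submodule 𝕜 B) {n : ℕ}
    (m : MultilinearMap 𝕜 (fun _ : Fin n => B) W) : Prop :=
  ∀ (σ : Equiv.Perm (Fin n)) (d : Fin n → ℤ) (v : Fin n → B), (∀ i, v i ∈ 𝓑 (d i)) →
    (m fun i => v (σ i)) = chi σ d • m v

end Multilinear

/-! ### `L∞`-algebras and weak `L∞`-morphisms to a dg-Lie algebra

The families below are indexed by `ℕ`, but their members with index `0` play no role. -/

/-- The maps `l n`, `n ≥ 1`, give the graded vector space an `L∞`-algebra structure. In the sum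
`i + j = n + 1` with `i, j ≥ 1`, so that `j = n - i + 1`. -/
structure IsLInfinityAlgebra {𝕜 B : Type*} [Field 𝕜] [AddCommGroup B] [Module 𝕜 B]
    (𝓑 : ℤ → Submodule 𝕜 B) (l : (n : ℕ) → MultilinearMap 𝕜 (fun _ : Fin n => B) B) : Prop where
  degree : ∀ n : ℕ, 1 ≤ n → HasDegree 𝓑 𝓑 (l n) (2 - n)
  skew : ∀ n : ℕ, 1 ≤ n → IsSkew 𝓑 (l n)
  relation : ∀ n : ℕ, 1 ≤ n → ∀ (d : Fin n → ℤ) (v : Fin n → B), (∀ i, v i ∈ 𝓑 (d i)) →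
    ∑ i : Finset.Icc 1 n, ∑ σ ∈ unshuffles n i,
      (((i : ℤ) * ((n : ℤ) - i)).negOnePow * chi σ d) •
        insertPerm (Finset.mem_Icc.1 i.2).2 (l (n - i + 1)) (l i) σ v = 0

/-- The maps `φ n`, `n ≥ 1`, are a weak `L∞`-morphism from the `L∞`-algebra with operations `l n`
to a dg-Lie algebra. In the sums `j + k = n + 1` with `j, k ≥ 1`, so that `j = n - k + 1`, and
`s + t = n` with `s, t ≥ 1`. -/
structure IsWeakLInfinityMorphism {𝕜 B C : Type*} [Field 𝕜] [AddCommGroup B] [Module 𝕜 B]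
    [AddCommGroup C] [Module 𝕜 C] (𝓑 : ℤ → Submodule 𝕜 B) {𝓒 : ℤ → Submodule 𝕜 C}
    (l : (n : ℕ) → MultilinearMap 𝕜 (fun _ : Fin n => B) B) (Y : DGLieStructure 𝓒)
    (φ : (n : ℕ) → MultilinearMap 𝕜 (fun _ : Fin n => B) C) : Prop where
  degree : ∀ n : ℕ, 1 ≤ n → HasDegree 𝓑 𝓒 (φ n) (1 - n)
  skew : ∀ n : ℕ, 1 ≤ n → IsSkew 𝓑 (φ n)
  relation : ∀ n : ℕ, 1 ≤ n → ∀ (d : Fin n → ℤ) (v : Fin n → B), (∀ i, v i ∈ 𝓑 (d i)) →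
    Y.d (φ n v)
    + ∑ k : Finset.Icc 1 n, ∑ σ ∈ unshuffles n k,
        (chi σ d * ((k : ℤ) * ((n : ℤ) - k) + 1).negOnePow) •
          insertPerm (Finset.mem_Icc.1 k.2).2 (φ (n - k + 1)) (l k) σ v
    + ∑ s : Finset.Ico 1 n, ∑ τ ∈ unshufflesMinus n s,
        (chi τ d * kappa τ s d) •
          bracketPerm Y.bracket (Finset.mem_Ico.1 s.2).2.le (φ s) (φ (n - s)) τ v = 0

/-! ### The transferred structure -/

namespace Contraction

variable {𝕜 B C : Type*} [Field 𝕜] [AddCommGroup B] [Module 𝕜 B] [AddCommGroup C] [Module 𝕜 C]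
  {𝓑 : ℤ → Submodule 𝕜 B} [DirectSum.Decomposition 𝓑] {𝓒 : ℤ → Submodule 𝕜 C}
  {X : CochainStructure 𝓑} {Y : DGLieStructure 𝓒}

mutual

/-- `vₙ = ∑_{1 ≤ t < n} ∑_{τ} χ(τ) κ(τ)_t [φ_t, φ_{n-t}] τ̂`, over the `(t, n-t)`-unshuffles `τ`
with `τ(1) < τ(t+1)`; in particular `v₁ = 0`. -/
noncomputable def v (R : Contraction X Y.toCochainStructure) (n : ℕ) :
    MultilinearMap 𝕜 (fun _ : Fin n => B) C :=
  ofHomogeneous 𝓑 fun d => ∑ t : Finset.Ico 1 n, ∑ τ ∈ unshufflesMinus n t,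
    (chi τ d * kappa τ t d) •
      bracketPerm Y.bracket (Finset.mem_Ico.1 t.2).2.le (φ R t) (φ R (n - t)) τ
termination_by (n, 0)
decreasing_by all_goals (have ht := Finset.mem_Ico.1 t.2; apply Prod.Lex.left; omega)

/-- `uₙ = ∑_{2 ≤ k ≤ n} ∑_{τ} (-1)^{k(n-k)+1} χ(τ) φ_{n-k+1} (l_k ⊗ Id^{⊗(n-k)}) τ̂`, over the
`(k, n-k)`-unshuffles `τ`; in particular `u₁ = 0`. Only `l_k = F v_k` with `k ≥ 2` occur here. -/
noncomputable def u (R : Contraction X Y.toCochainStructure) (n : ℕ) :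
    MultilinearMap 𝕜 (fun _ : Fin n => B) C :=
  ofHomogeneous 𝓑 fun d => ∑ k : Finset.Icc 2 n, ∑ τ ∈ unshuffles n k,
    (((k : ℤ) * ((n : ℤ) - k) + 1).negOnePow * chi τ d) •
      insertPerm (Finset.mem_Icc.1 k.2).2 (φ R (n - k + 1)) (R.F.compMultilinearMap (v R k)) τ
termination_by (n, 1)
decreasing_by
  all_goals
    have hk := Finset.mem_Icc.1 k.2
    rw [Prod.lex_def]
    simp only
    omega

/-- `φ₁ = G`, and `φₙ = H (uₙ + vₙ)` for `n > 1`. -/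
noncomputable def φ (R : Contraction X Y.toCochainStructure) :
    (n : ℕ) → MultilinearMap 𝕜 (fun _ : Fin n => B) C
  | 0 => 0
  | 1 => MultilinearMap.ofSubsingleton 𝕜 B C (0 : Fin 1) R.G
  | n + 2 => R.H.compMultilinearMap (u R (n + 2) + v R (n + 2))
termination_by n => (n, 2)
decreasing_by all_goals (apply Prod.Lex.right; omega)

end

/-- `l₁` is the differential of `B`, and `lₙ = F vₙ` for `n > 1`. -/
noncomputable def l (R : Contraction X Y.toCochainStructure) :
    (n : ℕ) → MultilinearMap 𝕜 (fun _ : Fin n => B) B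
  | 0 => 0
  | 1 => MultilinearMap.ofSubsingleton 𝕜 B B (0 : Fin 1) X.d
  | n + 2 => R.F.compMultilinearMap (v R (n + 2))

/-! The recursive description of `l`, `v`, `u`, `φ`. -/

theorem l_one (R : Contraction X Y.toCochainStructure) (x : B) : R.l 1 ![x] = X.d x := rfl

theorem l_apply (R : Contraction X Y.toCochainStructure) (n : ℕ) (hn : 2 ≤ n) (f : Fin n → B) :
    R.l n f = R.F (R.v n f) := by
  obtain ⟨n, rfl⟩ := Nat.exists_eq_add_of_le' hn
  rfl

theorem φ_one (R : Contraction X Y.toCochainStructure) (x : B) : R.φ 1 ![x] = R.G x := by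
  rw [φ]
  rfl

theorem φ_apply (R : Contraction X Y.toCochainStructure) (n : ℕ) (hn : 2 ≤ n) (f : Fin n → B) :
    R.φ n f = R.H (R.u n f + R.v n f) := by
  obtain ⟨n, rfl⟩ := Nat.exists_eq_add_of_le' hn
  rw [φ]
  rfl

theorem v_apply (R : Contraction X Y.toCochainStructure) (n : ℕ) (d : Fin n → ℤ) (f : Fin n → B)
    (hf : ∀ i, f i ∈ 𝓑 (d i)) :
    R.v n f = ∑ t : Finset.Ico 1 n, ∑ τ ∈ unshufflesMinus n t, (chi τ d * kappa τ t d) •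
      Y.bracket (R.φ t fun i => f (τ (firstIdx (Finset.mem_Ico.1 t.2).2.le i)))
        (R.φ (n - t) fun i => f (τ (lastIdx t i))) := by
  rw [v, ofHomogeneous_apply 𝓑 _ d f hf]
  simp only [_root_.sum_apply, _root_.smul_apply]
  rfl

theorem u_apply (R : Contraction X Y.toCochainStructure) (n : ℕ) (d : Fin n → ℤ) (f : Fin n → B)
    (hf : ∀ i, f i ∈ 𝓑 (d i)) :
    R.u n f = ∑ k : Finset.Icc 2 n, ∑ τ ∈ unshuffles n k,
      (((k : ℤ) * ((n : ℤ) - k) + 1).negOnePow * chi τ d) •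
        R.φ (n - k + 1) (Fin.cons
          (R.l k fun i => f (τ (firstIdx (Finset.mem_Icc.1 k.2).2 i)))
          fun i => f (τ (lastIdx k i))) := by
  rw [u, ofHomogeneous_apply 𝓑 _ d f hf]
  simp only [_root_.sum_apply, _root_.smul_apply]
  refine Finset.sum_congr rfl fun k _ => Finset.sum_congr rfl fun τ _ => ?_
  rw [l_apply R k (Finset.mem_Icc.1 k.2).1]
  rfl

end Contraction

end LInfTransfer

/-!
The statement is the assertion that the curvature of a twisting function vanishes, read through the
décalage isomorphism. After the shift of degrees by one and multiplication by the sign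
`(-1)^{∑ (n - i) deg xᵢ}` (`shiftedEval`), skew symmetric maps become graded symmetric functions of
words of homogeneous elements (`Letter`), and every sum over unshuffles becomes an unshuffle
coproduct with plain Koszul signs (`unshuffleSum`, related to permutations by `unshuffleSum_ofFn`,
`sum_insertPerm` and `sum_bracketPerm`). This coproduct is coassociative and graded cocommutative
(`unshuffleSum_assoc`, `unshuffleSum_comm`), and it carries graded symmetric functions to graded
symmetric functions (`adjSymmetric_unshuffleSum`), which gives the skew symmetry of `lₙ` and `φₙ`.

On words, the left-hand sides of the two families of relations are the Jacobiator
`J(L) = ∑ ± l(l(A), D)` and the curvature `E(L) = d φ(L) - ∑ ± φ(l(A), D) + v(L)`, where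
`2 v(L) = ∑ ± [φ(A), φ(D)]`. For graded symmetric `φ` and any operations `l` of the right
degrees they satisfy the Bianchi identity (`bianchi`)
`d E(L) + ∑ ± E(l(A), D) + ∑ ± φ(J(A), D) = ∑ ± [E(A), φ(D)]`.

Suppose that `E` and `J` vanish on words shorter than `L`, where `L` has length `n ≥ 2`, and put
`w = uₙ + vₙ`. Then the Bianchi identity reduces to `d w + w δ + G J = 0` on `L`, where `w δ` denotes
the insertion of the differential of `B` into `w`. Since `F G = Id` and `F H = 0`, one has
`F w = 0`, so that applying `F` gives `J(L) = 0`, and hence `d w + w δ = 0`. As `φ = H w` and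
`d H w = G F w - w - H d w = - w - H d w`, the curvature is `E(L) = - H (d w + w δ) = 0`
(`curvature_jacobiator_eq_zero`).
-/

namespace LInfTransfer

/-! ### Signs and sums over unshuffles of words -/

/-- The sign `(-1)^a` of a parity `a`. -/
def eps (a : ZMod 2) : ℤ := if a = 0 then 1 else -1

@[simp] theorem eps_zero : eps 0 = 1 := rfl

theorem eps_add (a b : ZMod 2) : eps (a + b) = eps a * eps b := by revert a b; decide

theorem eps_mul_self (a : ZMod 2) : eps a * eps a = 1 := by revert a; decide

theorem eq_zero_of_eps_smul {M : Type*} [AddCommGroup M] {a : ZMod 2} {x : M}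
    (h : eps a • x = 0) : x = 0 := by
  rw [← one_smul ℤ x, ← eps_mul_self a, mul_smul, h, smul_zero]

theorem coe_negOnePow (n : ℤ) : ((n.negOnePow : ℤˣ) : ℤ) = eps (n : ZMod 2) := by
  rcases Int.even_or_odd n with h | h
  · rw [Int.negOnePow_even n h, (ZMod.intCast_eq_zero_iff_even).2 h]; rfl
  · rw [Int.negOnePow_odd n h, (ZMod.intCast_eq_one_iff_odd).2 h]; rfl

section Words

variable {X M N : Type*} [AddCommGroup M] [AddCommGroup N]

/-- The product of the commutation factors `c x a` over the letters `a` of a word. -/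
def moveSign (c : X → X → ℤ) (x : X) (A : List X) : ℤ := (A.map (c x)).prod

/-- The sum, over all ways to split the word `L` into a subword `A` and the complementary subword
`B`, of `± f A B`. The sign is the product of the factors `c x a` over all letters `x` of `B` that
precede a letter `a` of `A` in `L`. In other words, `f` is applied to the unshuffle coproduct
of `L`. -/
def unshuffleSum (c : X → X → ℤ) : List X → (List X → List X → M) → M
  | [], f => f [] []
  | x :: L, f => unshuffleSum c L (fun A B => f (x :: A) B) +
      unshuffleSum c L (fun A B => moveSign c x A • f A (x :: B))

variable (c : X → X → ℤ)

@[simp] theorem unshuffleSum_nil (f : List X → List X → M) : unshuffleSum c [] f = f [] [] := rfl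

theorem unshuffleSum_cons (x : X) (L : List X) (f : List X → List X → M) :
    unshuffleSum c (x :: L) f = unshuffleSum c L (fun A B => f (x :: A) B) +
      unshuffleSum c L (fun A B => moveSign c x A • f A (x :: B)) := rfl

theorem unshuffleSum_congr {L : List X} {f g : List X → List X → M}
    (h : ∀ A B, (A ++ B).Perm L → f A B = g A B) : unshuffleSum c L f = unshuffleSum c L g := by
  induction L generalizing f g with
  | nil => exact h [] [] (List.Perm.refl _)
  | cons x L ih =>
    rw [unshuffleSum_cons, unshuffleSum_cons]
    congr 1
    · exact ih fun A B hAB => h _ _ (hAB.cons x)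
    · exact ih fun A B hAB => by rw [h A (x :: B) (List.perm_middle.trans (hAB.cons x))]

theorem unshuffleSum_add (L : List X) (f g : List X → List X → M) :
    unshuffleSum c L (fun A B => f A B + g A B) = unshuffleSum c L f + unshuffleSum c L g := by
  induction L generalizing f g with
  | nil => rfl
  | cons x L ih =>
    simp only [unshuffleSum_cons, smul_add, ih]
    abel

theorem map_unshuffleSum (D : M →+ N) (L : List X) (f : List X → List X → M) :
    D (unshuffleSum c L f) = unshuffleSum c L (fun A B => D (f A B)) := by
  induction L generalizing f with
  | nil => rfl
  | cons x L ih => simp only [unshuffleSum_cons, map_add, ih, map_zsmul]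

theorem unshuffleSum_smul (z : ℤ) (L : List X) (f : List X → List X → M) :
    unshuffleSum c L (fun A B => z • f A B) = z • unshuffleSum c L f :=
  (map_unshuffleSum c (zsmulAddGroupHom z) L f).symm

theorem unshuffleSum_neg (L : List X) (f : List X → List X → M) :
    unshuffleSum c L (fun A B => - f A B) = - unshuffleSum c L f :=
  (map_unshuffleSum c (-AddMonoidHom.id M) L f).symm

theorem unshuffleSum_sub (L : List X) (f g : List X → List X → M) :
    unshuffleSum c L (fun A B => f A B - g A B) = unshuffleSum c L f - unshuffleSum c L g := by
  simp only [sub_eq_add_neg, unshuffleSum_add, unshuffleSum_neg]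

@[simp] theorem unshuffleSum_zero (L : List X) :
    unshuffleSum c L (fun _ _ => (0 : M)) = 0 :=
  (map_unshuffleSum c (0 : M →+ M) L (fun _ _ => 0)).symm

theorem unshuffleSum_eq_zero {L : List X} {f : List X → List X → M}
    (h : ∀ A B, (A ++ B).Perm L → f A B = 0) : unshuffleSum c L f = 0 :=
  (unshuffleSum_congr c h).trans (unshuffleSum_zero c L)

/-- If `f` vanishes whenever its second argument is a nonempty word, only the splitting of `L` with
empty second part contributes. -/
theorem unshuffleSum_eq_left {L : List X} {f : List X → List X → M}
    (h : ∀ A B, (A ++ B).Perm L → B ≠ [] → f A B = 0) : unshuffleSum c L f = f L [] := by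
  induction L generalizing f with
  | nil => rfl
  | cons x L ih =>
    rw [unshuffleSum_cons, ih fun A B hAB hB => h _ _ (hAB.cons x) hB,
      unshuffleSum_eq_zero c fun A B hAB => by
        rw [h A (x :: B) (List.perm_middle.trans (hAB.cons x)) (by simp), smul_zero], add_zero]

theorem moveSign_append (x : X) (A B : List X) :
    moveSign c x (A ++ B) = moveSign c x A * moveSign c x B := by
  simp [moveSign]

theorem moveSign_perm (x : X) {A B : List X} (h : A.Perm B) : moveSign c x A = moveSign c x B :=
  (h.map _).prod_eq

/-- Coassociativity of the unshuffle coproduct. -/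
theorem unshuffleSum_assoc (L : List X) (f : List X → List X → List X → M) :
    unshuffleSum c L (fun A B => unshuffleSum c A fun A₁ A₂ => f A₁ A₂ B) =
      unshuffleSum c L (fun A B => unshuffleSum c B fun B₁ B₂ => f A B₁ B₂) := by
  induction L generalizing f with
  | nil => rfl
  | cons x L ih =>
    simp only [unshuffleSum_cons, unshuffleSum_add, smul_add, ← unshuffleSum_smul]
    rw [ih fun A₁ A₂ B => f (x :: A₁) A₂ B, ih fun A₁ A₂ B => moveSign c x A₁ • f A₁ (x :: A₂) B,
      unshuffleSum_congr c (g := fun A B => unshuffleSum c A fun A₁ A₂ =>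
        moveSign c x A₁ • moveSign c x A₂ • f A₁ A₂ (x :: B)) fun A B _ =>
        unshuffleSum_congr c fun A₁ A₂ h => by
          rw [smul_smul, ← moveSign_append, moveSign_perm c x h],
      ih fun A₁ A₂ B => moveSign c x A₁ • moveSign c x A₂ • f A₁ A₂ (x :: B), add_assoc]

end Words

section Parity

variable {X M : Type*} [AddCommGroup M] (p : X → ZMod 2)

/-- The parity of a word: the sum of the parities of its letters. -/
def wordParity (L : List X) : ZMod 2 := (L.map p).sum

/-- The Koszul commutation factor `(-1)^{|x||y|}`. -/
def koszulFactor (x y : X) : ℤ := eps (p x * p y)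

@[simp] theorem wordParity_nil : wordParity p [] = 0 := rfl

@[simp] theorem wordParity_cons (x : X) (L : List X) :
    wordParity p (x :: L) = p x + wordParity p L := by simp [wordParity]

@[simp] theorem wordParity_append (A B : List X) :
    wordParity p (A ++ B) = wordParity p A + wordParity p B := by simp [wordParity]

theorem wordParity_perm {A B : List X} (h : A.Perm B) : wordParity p A = wordParity p B :=
  (h.map _).sum_eq

theorem wordParity_split {A B L : List X} (h : (A ++ B).Perm L) :
    wordParity p L = wordParity p A + wordParity p B := by
  rw [← wordParity_append, wordParity_perm p h]

theorem moveSign_koszulFactor (x : X) (A : List X) :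
    moveSign (koszulFactor p) x A = eps (p x * wordParity p A) := by
  induction A with
  | nil => simp [moveSign]
  | cons a A ih =>
    rw [wordParity_cons, mul_add, eps_add, ← ih]
    simp [moveSign, koszulFactor]

/-- Graded cocommutativity of the unshuffle coproduct. -/
theorem unshuffleSum_comm (L : List X) (f : List X → List X → M) :
    unshuffleSum (koszulFactor p) L f = unshuffleSum (koszulFactor p) L
      (fun A B => eps (wordParity p A * wordParity p B) • f B A) := by
  induction L generalizing f with
  | nil => simp
  | cons x L ih =>
    rw [unshuffleSum_cons, unshuffleSum_cons, ih, ih fun A B => _ • f A (x :: B), add_comm]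
    congr 1 <;> refine unshuffleSum_congr _ fun A B _ => ?_
    · rw [moveSign_koszulFactor, smul_smul, ← eps_add]
      congr 2
      rw [wordParity_cons]
      ring
    · rw [moveSign_koszulFactor, smul_smul, ← eps_add]
      congr 2
      rw [wordParity_cons]
      generalize p x = a, wordParity p A = b, wordParity p B = d
      revert a b d
      decide

/-- Exchange of the last two parts of a splitting into three parts. -/
theorem unshuffleSum_comm_right (L : List X) (f : List X → List X → List X → M) :
    unshuffleSum (koszulFactor p) L
        (fun A B => unshuffleSum (koszulFactor p) B fun B₁ B₂ => f A B₁ B₂) =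
      unshuffleSum (koszulFactor p) L
        (fun A B => unshuffleSum (koszulFactor p) B fun B₁ B₂ =>
          eps (wordParity p B₁ * wordParity p B₂) • f A B₂ B₁) :=
  unshuffleSum_congr _ fun A B _ => unshuffleSum_comm p B (f A)

/-- Exchange of the first two parts of a splitting into three parts. -/
theorem unshuffleSum_comm_left (L : List X) (f : List X → List X → List X → M) :
    unshuffleSum (koszulFactor p) L
        (fun A B => unshuffleSum (koszulFactor p) B fun B₁ B₂ => f A B₁ B₂) =
      unshuffleSum (koszulFactor p) L
        (fun A B => unshuffleSum (koszulFactor p) B fun B₁ B₂ =>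
          eps (wordParity p A * wordParity p B₁) • f B₁ A B₂) := by
  rw [← unshuffleSum_assoc, ← unshuffleSum_assoc _ _ fun A B₁ B₂ => _ • f B₁ A B₂]
  exact unshuffleSum_congr _ fun A B _ => unshuffleSum_comm p A fun A₁ A₂ => f A₁ A₂ B

/-- On words of length `n`, the function `g` is graded symmetric: exchanging two adjacent letters
`x` and `y` multiplies the value by `c x y`. -/
def AdjSymmetric (c : X → X → ℤ) (n : ℕ) (g : List X → M) : Prop :=
  ∀ P x y Q, (P ++ x :: y :: Q).length = n → g (P ++ x :: y :: Q) = c x y • g (P ++ y :: x :: Q)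

theorem AdjSymmetric.cons {c : X → X → ℤ} {n : ℕ} {g : List X → M}
    (h : AdjSymmetric c (n + 1) g) (z : X) : AdjSymmetric c n fun A => g (z :: A) :=
  fun P x y Q hn => h (z :: P) x y Q (by simpa using hn)

/-- A sum over the splittings of a word is graded symmetric if the summand is graded symmetric in
each of the two parts. -/
theorem adjSymmetric_unshuffleSum {n : ℕ} {f : List X → List X → M}
    (hA : ∀ k B, k + B.length = n → AdjSymmetric (koszulFactor p) k fun A => f A B)
    (hB : ∀ k A, A.length + k = n → AdjSymmetric (koszulFactor p) k fun B => f A B) :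
    AdjSymmetric (koszulFactor p) n fun L => unshuffleSum (koszulFactor p) L f := by
  intro P
  induction P generalizing n f with
  | nil =>
    intro x y Q hn
    simp only [List.nil_append, unshuffleSum_cons, smul_add, ← unshuffleSum_smul,
      moveSign_koszulFactor]
    -- the four ways to distribute `x` and `y` over the two parts; the mixed ones trade places
    have key : ∀ {a b c d a' b' c' d' : M}, a = a' → b = c' → c = b' → d = d' →
        a + b + (c + d) = a' + b' + (c' + d') := by
      rintro a b c d _ _ _ _ rfl rfl rfl rfl
      abel
    refine key (unshuffleSum_congr _ fun A B h => ?_) (unshuffleSum_congr _ fun A B h => ?_)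
      (unshuffleSum_congr _ fun A B h => ?_) (unshuffleSum_congr _ fun A B h => ?_)
    · refine hA _ B ?_ [] x y A rfl
      have := h.length_eq
      simp at this hn ⊢
      omega
    · rw [smul_smul, koszulFactor, wordParity_cons, ← eps_add]
      congr 2
      generalize p x = a, wordParity p A = b, p y = d
      revert a b d
      decide
    · rw [smul_smul, koszulFactor, wordParity_cons, mul_add, eps_add]
    · have h2 := hB (B.length + 2) A (by
        have := h.length_eq
        simp at this hn ⊢
        omega) [] x y B (by simp)
      simp only [List.nil_append] at h2
      rw [h2]
      simp only [smul_smul]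
      congr 1
      ring
  | cons z P ih =>
    intro x y Q hn
    obtain ⟨m, rfl⟩ : ∃ m, n = m + 1 := ⟨_, hn.symm⟩
    simp only [List.cons_append, unshuffleSum_cons, smul_add]
    congr 1
    · refine ih (n := m) (f := fun A B => f (z :: A) B) (fun k B hk => ?_) (fun k A hk => ?_)
        x y Q (by simpa using hn)
      · exact (hA (k + 1) B (by omega)).cons z
      · exact hB k (z :: A) (by simp; omega)
    · refine ih (n := m) (f := fun A B => moveSign (koszulFactor p) z A • f A (z :: B))
        (fun k B hk => ?_) (fun k A hk => ?_) x y Q (by simpa using hn)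
      · intro P' x' y' Q' hl
        have h2 := hA k (z :: B) (by simp; omega) P' x' y' Q' hl
        simp only at h2 ⊢
        rw [h2, moveSign_perm (A := P' ++ x' :: y' :: Q') (B := P' ++ y' :: x' :: Q') _ _
          ((List.Perm.swap _ _ _).append_left _), smul_smul, smul_smul, mul_comm]
      · intro P' x' y' Q' hl
        have h2 := (hB (k + 1) A (by omega)).cons z P' x' y' Q' hl
        simp only at h2 ⊢
        rw [h2, smul_smul, smul_smul, mul_comm]

end Parity

/-! ### The Bianchi identity -/

section Bianchi

variable {𝕜 X C : Type*} [Field 𝕜] [AddCommGroup C] [Module 𝕜 C]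

section

variable (br : C →ₗ[𝕜] C →ₗ[𝕜] C)

theorem bracket_zsmul_left (n : ℤ) (x y : C) : br (n • x) y = n • br x y := by
  rw [map_zsmul]; rfl

theorem bracket_zsmul_right (n : ℤ) (x y : C) : br x (n • y) = n • br x y := map_zsmul _ _ _

theorem bracket_unshuffleSum_left (c : X → X → ℤ) (L : List X) (f : List X → List X → C) (y : C) :
    br (unshuffleSum c L f) y = unshuffleSum c L fun A B => br (f A B) y :=
  map_unshuffleSum c (br.flip y).toAddMonoidHom L f

theorem linearMap_unshuffleSum {W : Type*} [AddCommGroup W] [Module 𝕜 W] (g : C →ₗ[𝕜] W)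
    (c : X → X → ℤ) (L : List X) (f : List X → List X → C) :
    g (unshuffleSum c L f) = unshuffleSum c L fun A B => g (f A B) :=
  map_unshuffleSum c g.toAddMonoidHom L f

end

variable [IsAddTorsionFree C] (p : X → ZMod 2)

/-- Inserting an odd operation twice into a graded symmetric map: only the terms in which the
second insertion contains the result of the first one survive. -/
theorem unshuffleSum_insert_insert (φ : List X → C) (lam : List X → X)
    (hlam : ∀ A, p (lam A) = wordParity p A + 1) (L : List X)
    (hswap : ∀ A B V, (A ++ B ++ V).Perm L → φ (lam A :: lam B :: V) =
      eps ((wordParity p A + 1) * (wordParity p B + 1)) • φ (lam B :: lam A :: V)) :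
    unshuffleSum (koszulFactor p) L (fun A B =>
        unshuffleSum (koszulFactor p) (lam A :: B) fun U V => φ (lam U :: V)) =
      unshuffleSum (koszulFactor p) L (fun A B =>
        unshuffleSum (koszulFactor p) A fun A₁ A₂ => φ (lam (lam A₁ :: A₂) :: B)) := by
  -- exchanging the two inserted subwords changes the sign of the sum of the other terms
  have hT : unshuffleSum (koszulFactor p) L (fun A B => unshuffleSum (koszulFactor p) B fun U V =>
      moveSign (koszulFactor p) (lam A) U • φ (lam U :: lam A :: V)) = 0 := by
    set T := unshuffleSum (koszulFactor p) L (fun A B =>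
      unshuffleSum (koszulFactor p) B fun U V =>
        moveSign (koszulFactor p) (lam A) U • φ (lam U :: lam A :: V)) with hT
    have h : T = -T := by
      conv_lhs => rw [hT, unshuffleSum_comm_left]
      rw [hT, ← unshuffleSum_neg]
      refine unshuffleSum_congr _ fun A B h => ?_
      rw [← unshuffleSum_neg]
      refine unshuffleSum_congr _ fun U V h' => ?_
      rw [hswap A U V (by
        rw [List.append_assoc]
        exact (h'.append_left A).trans h), moveSign_koszulFactor, moveSign_koszulFactor, hlam, hlam,
        smul_smul, smul_smul, ← neg_smul]
      congr 1
      generalize wordParity p A = a, wordParity p U = b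
      revert a b
      decide
    exact self_eq_neg.1 h
  simp only [unshuffleSum_cons, unshuffleSum_add]
  rw [hT, add_zero, unshuffleSum_assoc _ _ fun A₁ A₂ B => φ (lam (lam A₁ :: A₂) :: B)]

variable (d : C →ₗ[𝕜] C) (br : C →ₗ[𝕜] C →ₗ[𝕜] C) (φ v : List X → C)

/-- The differential of half the self-bracket of `φ`. -/
theorem d_halfBracket
    (hskewd : ∀ A B, br (φ A) (d (φ B)) =
      - eps ((wordParity p A + 1) * wordParity p B) • br (d (φ B)) (φ A))
    (hleib : ∀ A B, d (br (φ A) (φ B)) =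
      br (d (φ A)) (φ B) + eps (wordParity p A + 1) • br (φ A) (d (φ B)))
    (hv : ∀ L, v L + v L = unshuffleSum (koszulFactor p) L fun A B =>
      eps (wordParity p A + 1) • br (φ A) (φ B)) (L : List X) :
    d (v L) = unshuffleSum (koszulFactor p) L fun A B =>
      eps (wordParity p A + 1) • br (d (φ A)) (φ B) := by
  have h1 : unshuffleSum (koszulFactor p) L (fun A B => br (φ A) (d (φ B))) =
      unshuffleSum (koszulFactor p) L fun A B =>
        eps (wordParity p A + 1) • br (d (φ A)) (φ B) := by
    rw [unshuffleSum_comm]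
    refine unshuffleSum_congr _ fun A B _ => ?_
    rw [hskewd, smul_smul]
    congr 1
    generalize wordParity p A = a, wordParity p B = b
    revert a b
    decide
  have h2 : d (v L) + d (v L) = unshuffleSum (koszulFactor p) L (fun A B =>
      eps (wordParity p A + 1) • br (d (φ A)) (φ B)) + unshuffleSum (koszulFactor p) L (fun A B =>
      eps (wordParity p A + 1) • br (d (φ A)) (φ B)) := by
    rw [← map_add, hv, linearMap_unshuffleSum]
    nth_rewrite 2 [← h1]
    rw [← unshuffleSum_add]
    refine unshuffleSum_congr _ fun A B _ => ?_
    rw [map_zsmul, hleib, smul_add, smul_smul, eps_mul_self, one_smul]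
  rw [← two_nsmul, ← two_nsmul] at h2
  exact nsmul_right_injective two_ne_zero h2

/-- The Jacobi identity for the self-bracket of `φ`. -/
theorem bracket_halfBracket
    (hjac : ∀ A B D, br (br (φ A) (φ B)) (φ D)
      + eps ((wordParity p A + 1) * (wordParity p B + wordParity p D)) • br (br (φ B) (φ D)) (φ A)
      - eps ((wordParity p B + 1) * (wordParity p D + 1)) • br (br (φ A) (φ D)) (φ B) = 0)
    (hv : ∀ L, v L + v L = unshuffleSum (koszulFactor p) L fun A B =>
      eps (wordParity p A + 1) • br (φ A) (φ B)) (L : List X) :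
    unshuffleSum (koszulFactor p) L (fun A B => eps (wordParity p A + 1) • br (v A) (φ B)) = 0 := by
  set K := unshuffleSum (koszulFactor p) L (fun A B => unshuffleSum (koszulFactor p) B fun U V =>
    eps (wordParity p U) • br (br (φ A) (φ U)) (φ V)) with hK
  have h2 : K = unshuffleSum (koszulFactor p) L
      (fun A B => unshuffleSum (koszulFactor p) B fun U V =>
        eps (wordParity p U * wordParity p V) • eps (wordParity p V) •
          br (br (φ A) (φ V)) (φ U)) := by
    rw [hK, unshuffleSum_comm_right]
  have h3 : K = unshuffleSum (koszulFactor p) L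
      (fun A B => unshuffleSum (koszulFactor p) B fun U V =>
        eps (wordParity p A * wordParity p U) • eps (wordParity p A * wordParity p V) •
          eps (wordParity p V) • br (br (φ U) (φ V)) (φ A)) := by
    rw [h2, unshuffleSum_comm_left]
  -- the three expressions of `K` add up to a sum of Jacobi identities
  have h4 : K + K + K = 0 := by
    conv_lhs => enter [1, 1]; rw [hK]
    conv_lhs => enter [1, 2]; rw [h3]
    conv_lhs => enter [2]; rw [h2]
    rw [← unshuffleSum_add, ← unshuffleSum_add]
    refine unshuffleSum_eq_zero _ fun A B _ => ?_
    rw [← unshuffleSum_add, ← unshuffleSum_add]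
    refine unshuffleSum_eq_zero _ fun U V _ => ?_
    have h5 := congrArg (eps (wordParity p U) • ·) (hjac A U V)
    simp only [smul_zero, smul_add, smul_sub, smul_smul] at h5
    rw [← h5, sub_eq_add_neg, ← neg_smul]
    simp only [smul_smul]
    congr 2
    · congr 1
      generalize wordParity p A = a, wordParity p U = b, wordParity p V = e
      revert a b e
      decide
    · generalize wordParity p U = b, wordParity p V = e
      revert b e
      decide
  have h5 : K = 0 := by
    have : 3 • K = 3 • (0 : C) := by rw [smul_zero, ← h4]; abel
    exact nsmul_right_injective (by norm_num) this
  refine self_eq_neg.1 (eq_neg_of_add_eq_zero_left ?_)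
  rw [← unshuffleSum_add, ← h5, hK,
    ← unshuffleSum_assoc _ L fun A U V => eps (wordParity p U) • br (br (φ A) (φ U)) (φ V)]
  refine unshuffleSum_congr _ fun A B _ => ?_
  rw [← smul_add, ← LinearMap.add_apply, ← map_add, hv, bracket_unshuffleSum_left,
    ← unshuffleSum_smul]
  refine unshuffleSum_congr _ fun U V h => ?_
  rw [bracket_zsmul_left, smul_smul, wordParity_split p h]
  congr 1
  generalize wordParity p V = b, wordParity p U = e
  revert b e
  decide

/-- The Bianchi identity for the curvature `E` of `φ`, which is
`E(L) = d φ(L) - ∑ ± φ(lam(A), B) + v(L)`. -/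
theorem bianchi (lam : List X → X) (E : List X → C)
    (hlam : ∀ A, p (lam A) = wordParity p A + 1)
    (hdd : ∀ x, d (d x) = 0)
    (hskewd : ∀ A B, br (φ A) (d (φ B)) =
      - eps ((wordParity p A + 1) * wordParity p B) • br (d (φ B)) (φ A))
    (hleib : ∀ A B, d (br (φ A) (φ B)) =
      br (d (φ A)) (φ B) + eps (wordParity p A + 1) • br (φ A) (d (φ B)))
    (hjac : ∀ A B D, br (br (φ A) (φ B)) (φ D)
      + eps ((wordParity p A + 1) * (wordParity p B + wordParity p D)) • br (br (φ B) (φ D)) (φ A)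
      - eps ((wordParity p B + 1) * (wordParity p D + 1)) • br (br (φ A) (φ D)) (φ B) = 0)
    (hv : ∀ L, v L + v L = unshuffleSum (koszulFactor p) L fun A B =>
      eps (wordParity p A + 1) • br (φ A) (φ B))
    (hvcons : ∀ x L, v (x :: L) = unshuffleSum (koszulFactor p) L fun A B =>
      eps (p x + wordParity p A + 1) • br (φ (x :: A)) (φ B))
    (hE : ∀ L, E L = d (φ L) -
      unshuffleSum (koszulFactor p) L (fun A B => φ (lam A :: B)) + v L)
    (L : List X)
    (hswap : ∀ A B V, (A ++ B ++ V).Perm L → φ (lam A :: lam B :: V) =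
      eps ((wordParity p A + 1) * (wordParity p B + 1)) • φ (lam B :: lam A :: V)) :
    d (E L) + unshuffleSum (koszulFactor p) L (fun A B => E (lam A :: B))
      + unshuffleSum (koszulFactor p) L (fun A B =>
        unshuffleSum (koszulFactor p) A fun A₁ A₂ => φ (lam (lam A₁ :: A₂) :: B))
      = unshuffleSum (koszulFactor p) L
        (fun A B => eps (wordParity p A + 1) • br (E A) (φ B)) := by
  -- the curvature solved for `d φ`
  have hdφ : ∀ L, d (φ L) = E L +
      unshuffleSum (koszulFactor p) L (fun A B => φ (lam A :: B)) - v L := fun L => by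
    rw [hE]; abel
  have hdE : d (E L) = - unshuffleSum (koszulFactor p) L (fun A B => d (φ (lam A :: B)))
      + unshuffleSum (koszulFactor p) L (fun A B =>
        eps (wordParity p A + 1) • br (d (φ A)) (φ B)) := by
    rw [hE, map_add, map_sub, hdd, zero_sub, linearMap_unshuffleSum,
      d_halfBracket p d br φ v hskewd hleib hv]
  -- the insertions into the bracket
  have hins : unshuffleSum (koszulFactor p) L (fun A B => v (lam A :: B)) =
      - unshuffleSum (koszulFactor p) L (fun A B => eps (wordParity p A + 1) •
        br (unshuffleSum (koszulFactor p) A (fun A₁ A₂ => φ (lam A₁ :: A₂))) (φ B)) := by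
    simp only [hvcons, bracket_unshuffleSum_left, ← unshuffleSum_smul]
    rw [unshuffleSum_congr _ (L := L) (g := fun A B => unshuffleSum (koszulFactor p) A fun U V =>
        eps (wordParity p U + wordParity p V + 1) • br (φ (lam U :: V)) (φ B)) fun A B _ =>
        unshuffleSum_congr _ fun U V h => by rw [wordParity_split p h],
      unshuffleSum_assoc _ _ fun U V B =>
        eps (wordParity p U + wordParity p V + 1) • br (φ (lam U :: V)) (φ B),
      ← unshuffleSum_neg]
    refine unshuffleSum_congr _ fun A B _ => ?_
    rw [← unshuffleSum_neg]
    refine unshuffleSum_congr _ fun U V _ => ?_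
    rw [hlam, ← neg_smul]
    congr 1
    generalize wordParity p A = a, wordParity p U = b
    revert a b
    decide
  rw [hdE]
  simp only [hdφ, map_add, map_sub, LinearMap.add_apply, LinearMap.sub_apply, smul_add, smul_sub,
    unshuffleSum_add, unshuffleSum_sub]
  rw [bracket_halfBracket p br φ v hjac hv, unshuffleSum_insert_insert p φ lam hlam L hswap, hins]
  abel

end Bianchi

/-! ### Sums over unshuffle permutations -/

section Unshuffles

/-- The permutation of `Fin (n + 1)` that takes the value `0` at `k` and agrees elsewhere with `σ`,
up to the order-preserving identifications. -/
def insertZero {n : ℕ} (k : Fin (n + 1)) (σ : Equiv.Perm (Fin n)) : Equiv.Perm (Fin (n + 1)) :=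
  (finSuccEquiv' k).trans ((Equiv.optionCongr σ).trans (finSuccEquiv' 0).symm)

variable {n : ℕ}

@[simp] theorem insertZero_self (k : Fin (n + 1)) (σ : Equiv.Perm (Fin n)) :
    insertZero k σ k = 0 := by
  simp [insertZero]

@[simp] theorem insertZero_succAbove (k : Fin (n + 1)) (σ : Equiv.Perm (Fin n)) (i : Fin n) :
    insertZero k σ (k.succAbove i) = (σ i).succ := by
  simp [insertZero]

@[simp] theorem insertZero_zero_succ (σ : Equiv.Perm (Fin n)) (i : Fin n) :
    insertZero 0 σ i.succ = (σ i).succ := by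
  simpa using insertZero_succAbove 0 σ i

theorem insertZero_eq_zero_iff (k i : Fin (n + 1)) (σ : Equiv.Perm (Fin n)) :
    insertZero k σ i = 0 ↔ i = k := by
  rw [← (insertZero k σ).injective.eq_iff (a := i), insertZero_self]

theorem insertZero_injective :
    Function.Injective fun q : Fin (n + 1) × Equiv.Perm (Fin n) => insertZero q.1 q.2 := by
  rintro ⟨k, σ⟩ ⟨m, τ⟩ h
  simp only at h
  obtain rfl : k = m := (insertZero_eq_zero_iff m k τ).1 (by rw [← h, insertZero_self])
  congr 1
  ext i
  have := congrArg (fun e => e (k.succAbove i)) h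
  simpa [Fin.ext_iff] using this

theorem exists_insertZero (τ : Equiv.Perm (Fin (n + 1))) : ∃ k σ, insertZero k σ = τ := by
  have h := (Fintype.bijective_iff_injective_and_card
    fun q : Fin (n + 1) × Equiv.Perm (Fin n) => insertZero q.1 q.2).2
    ⟨insertZero_injective, by simp [Fintype.card_perm, Nat.factorial_succ]⟩
  obtain ⟨⟨k, σ⟩, h⟩ := h.2 τ
  exact ⟨k, σ, h⟩

theorem mem_unshuffles {t : ℕ} {σ : Equiv.Perm (Fin n)} : σ ∈ unshuffles n t ↔
    ∀ i j : Fin n, i < j → (j.val < t ∨ t ≤ i.val) → σ i < σ j := by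
  simp only [unshuffles, Finset.mem_filter, Finset.mem_univ, true_and]
  exact ⟨fun h i j hij ht => ht.elim (h.1 i j hij) fun ht => h.2 i j ht hij,
    fun h => ⟨fun i j hij ht => h i j hij (Or.inl ht), fun i j ht hij => h i j hij (Or.inr ht)⟩⟩

theorem insertZero_zero_mem {t : ℕ} {σ : Equiv.Perm (Fin n)} :
    insertZero 0 σ ∈ unshuffles (n + 1) (t + 1) ↔ σ ∈ unshuffles n t := by
  simp only [mem_unshuffles, Fin.forall_fin_succ, insertZero_zero_succ, insertZero_self,
    Fin.succ_lt_succ_iff, Fin.val_succ, Fin.succ_pos, Fin.val_zero]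
  simp

theorem insertZero_mem {t : Fin (n + 1)} {σ : Equiv.Perm (Fin n)} :
    insertZero t σ ∈ unshuffles (n + 1) t ↔ σ ∈ unshuffles n t := by
  have hval : ∀ i : Fin n, (t.succAbove i).val = if i.val < t.val then i.val else i.val + 1 := by
    intro i
    simp only [Fin.succAbove, Fin.lt_def, Fin.val_castSucc]
    split_ifs <;> simp
  simp only [mem_unshuffles, Fin.forall_iff_succAbove t, insertZero_self, insertZero_succAbove,
    hval, Fin.lt_def, Fin.val_succ]
  constructor
  · rintro ⟨-, h⟩ i j hij hc
    have := (h i).2 j (by split_ifs <;> omega) (by split_ifs <;> omega)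
    omega
  · refine fun h => ⟨⟨by simp, by simp⟩, fun i => ⟨?_, fun j hij hc => ?_⟩⟩
    · intro h1 h2
      exfalso
      split_ifs at * <;> omega
    · have := h i j (by split_ifs at * <;> omega) (by split_ifs at * <;> omega)
      omega

theorem eq_of_insertZero_mem {t : ℕ} {k : Fin (n + 1)} {σ : Equiv.Perm (Fin n)}
    (h : insertZero k σ ∈ unshuffles (n + 1) t) : k = 0 ∨ k.val = t := by
  by_contra! hk
  have hk0 : k.val ≠ 0 := fun h => hk.1 (Fin.ext h)
  have := mem_unshuffles.1 h ⟨k.val - 1, by omega⟩ k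
    (by rw [Fin.lt_def]; simp only; omega) (by simp only; omega)
  simp at this

theorem filter_unshuffles_zero (t : ℕ) :
    {τ ∈ unshuffles (n + 1) (t + 1) | τ 0 = 0} = (unshuffles n t).image (insertZero 0) := by
  ext τ
  obtain ⟨k, σ, rfl⟩ := exists_insertZero τ
  simp only [Finset.mem_filter, Finset.mem_image, insertZero_eq_zero_iff]
  constructor
  · rintro ⟨h, rfl⟩
    exact ⟨σ, insertZero_zero_mem.1 h, rfl⟩
  · rintro ⟨σ', h, h'⟩
    obtain ⟨rfl, rfl⟩ := Prod.mk.inj (insertZero_injective (a₁ := (0, σ')) (a₂ := (k, σ)) h')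
    exact ⟨insertZero_zero_mem.2 h, rfl⟩

theorem filter_unshuffles_ne_zero (t : Fin (n + 1)) :
    {τ ∈ unshuffles (n + 1) t | ¬ (t ≠ 0 ∧ τ 0 = 0)} = (unshuffles n t).image (insertZero t) := by
  ext τ
  obtain ⟨k, σ, rfl⟩ := exists_insertZero τ
  simp only [Finset.mem_filter, Finset.mem_image, insertZero_eq_zero_iff]
  constructor
  · rintro ⟨h, hk⟩
    have hkt : k = t := by
      rcases eq_of_insertZero_mem h with h0 | h0
      · rw [not_and_or, not_not] at hk
        rcases hk with hk | hk
        · rw [h0, hk]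
        · exact absurd h0.symm hk
      · exact Fin.ext h0
    subst hkt
    exact ⟨σ, insertZero_mem.1 h, rfl⟩
  · rintro ⟨σ', h, h'⟩
    obtain ⟨rfl, rfl⟩ := Prod.mk.inj (insertZero_injective (a₁ := (t, σ')) (a₂ := (k, σ)) h')
    exact ⟨insertZero_mem.2 h, fun h => h.1 h.2.symm⟩

theorem insertZero_injective_right (k : Fin (n + 1)) :
    Function.Injective (insertZero k) := fun σ τ h =>
  (Prod.mk.inj (insertZero_injective (a₁ := (k, σ)) (a₂ := (k, τ)) h)).2

theorem unshufflesMinus_succ (t : ℕ) :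
    unshufflesMinus (n + 1) (t + 1) = (unshuffles n t).image (insertZero 0) := by
  rw [← filter_unshuffles_zero, unshufflesMinus]
  refine Finset.filter_congr fun τ hτ => ⟨fun h => ?_, fun h i j hi hj => ?_⟩
  · obtain ⟨k, σ, rfl⟩ := exists_insertZero τ
    rcases eq_of_insertZero_mem hτ with rfl | hk
    · simp
    · have := h 0 k rfl hk
      simp at this
  · obtain rfl : i = 0 := Fin.ext hi
    rw [h, Fin.pos_iff_ne_zero, ← h]
    intro h'
    have := τ.injective h'
    simp [this] at hj

variable {M : Type*} [AddCommGroup M]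

theorem sum_unshufflesMinus (g : ℕ → Equiv.Perm (Fin (n + 1)) → M) :
    ∑ t ∈ Finset.Ico 1 (n + 1), ∑ τ ∈ unshufflesMinus (n + 1) t, g t τ =
      ∑ t ∈ Finset.range n, ∑ σ ∈ unshuffles n t, g (t + 1) (insertZero 0 σ) := by
  rw [Finset.sum_Ico_eq_sum_range]
  refine Finset.sum_congr rfl fun t _ => ?_
  rw [add_comm 1 t, unshufflesMinus_succ,
    Finset.sum_image (insertZero_injective_right 0).injOn]

/-- Recursion for sums over all unshuffles, according to the part that contains the first
letter. -/
theorem sum_unshuffles_succ (g : ℕ → Equiv.Perm (Fin (n + 1)) → M) :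
    ∑ t : Fin (n + 2), ∑ τ ∈ unshuffles (n + 1) t, g t τ =
      ∑ t : Fin (n + 1), ∑ σ ∈ unshuffles n t, g (t + 1) (insertZero 0 σ) +
      ∑ t : Fin (n + 1), ∑ σ ∈ unshuffles n t, g t (insertZero t σ) := by
  have h : ∀ t : Fin (n + 2), ∑ τ ∈ unshuffles (n + 1) t, g t τ =
      ∑ τ ∈ unshuffles (n + 1) t with t ≠ 0 ∧ τ 0 = 0, g t τ +
      ∑ τ ∈ unshuffles (n + 1) t with ¬ (t ≠ 0 ∧ τ 0 = 0), g t τ := fun t =>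
    (Finset.sum_filter_add_sum_filter_not _ _ _).symm
  rw [Finset.sum_congr rfl fun t _ => h t, Finset.sum_add_distrib]
  congr 1
  · rw [Fin.sum_univ_succ, Finset.sum_eq_zero fun τ hτ => absurd rfl (Finset.mem_filter.1 hτ).2.1,
      zero_add]
    refine Finset.sum_congr rfl fun t _ => ?_
    have h2 : ∀ τ : Equiv.Perm (Fin (n + 1)), (t.succ ≠ 0 ∧ τ 0 = 0) ↔ τ 0 = 0 := fun τ =>
      and_iff_right (Fin.succ_ne_zero t)
    simp only [h2, Fin.val_succ]
    rw [filter_unshuffles_zero]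
    exact Finset.sum_image (insertZero_injective_right 0).injOn
  · rw [Fin.sum_univ_castSucc]
    have hlast : ({τ ∈ unshuffles (n + 1) (Fin.last (n + 1)) |
        ¬ (Fin.last (n + 1) ≠ 0 ∧ τ 0 = 0)} : Finset _) = ∅ := by
      refine Finset.filter_eq_empty_iff.2 fun τ hτ => ?_
      obtain ⟨k, σ, rfl⟩ := exists_insertZero τ
      rcases eq_of_insertZero_mem hτ with rfl | hk
      · exact fun h => h ⟨Fin.last_pos.ne', insertZero_self 0 σ⟩
      · have := k.isLt
        simp at hk
        omega
    rw [hlast, Finset.sum_empty, add_zero]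
    refine Finset.sum_congr rfl fun t _ => ?_
    have h1 := filter_unshuffles_ne_zero t
    have h2 : ∀ τ : Equiv.Perm (Fin (n + 1)), (¬ (t.castSucc ≠ 0 ∧ τ 0 = 0)) ↔
        ¬ (t ≠ 0 ∧ τ 0 = 0) := fun τ => by
      rw [ne_eq, ne_eq, Fin.castSucc_eq_zero_iff]
    simp only [h2, Fin.val_castSucc, h1]
    exact Finset.sum_image (insertZero_injective_right t).injOn

/-! ### Words and permutations -/

variable {X : Type*} (c : X → X → ℤ)

/-- The product of the commutation factors over all inversions of `σ`. -/
def inversionSign (σ : Equiv.Perm (Fin n)) (x : Fin n → X) : ℤ :=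
  ∏ i, ∏ j, if i < j ∧ σ j < σ i then c (x (σ j)) (x (σ i)) else 1

theorem ofFn_insertZero_zero (x : X) (xs : Fin n → X) (σ : Equiv.Perm (Fin n)) :
    (List.ofFn fun i => (Fin.cons x xs : Fin (n + 1) → X) (insertZero 0 σ i)) =
      x :: List.ofFn fun i => xs (σ i) := by
  simp [List.ofFn_succ]

theorem cons_insertZero (x : X) (xs : Fin n → X) (k i : Fin (n + 1)) (σ : Equiv.Perm (Fin n)) :
    (Fin.cons x xs : Fin (n + 1) → X) (insertZero k σ i) =
      k.insertNth (α := fun _ => X) x (fun i => xs (σ i)) i := by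
  refine Fin.succAboveCases k ?_ (fun i => ?_) i <;> simp

theorem take_ofFn_insertZero (x : X) (xs : Fin n → X) (k : Fin (n + 1)) (σ : Equiv.Perm (Fin n)) :
    (List.ofFn fun i => (Fin.cons x xs : Fin (n + 1) → X) (insertZero k σ i)).take k =
      (List.ofFn fun i => xs (σ i)).take k := by
  refine List.ext_getElem (by simp; omega) fun i h1 h2 => ?_
  simp only [List.getElem_take, List.getElem_ofFn, cons_insertZero]
  simp at h1 h2
  have : (⟨i, by omega⟩ : Fin (n + 1)) = k.succAbove ⟨i, h2.2⟩ := by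
    rw [Fin.succAbove_of_castSucc_lt _ _ (by simp [Fin.lt_def]; omega)]
    rfl
  rw [this, Fin.insertNth_apply_succAbove]

theorem drop_ofFn_insertZero (x : X) (xs : Fin n → X) (k : Fin (n + 1)) (σ : Equiv.Perm (Fin n)) :
    (List.ofFn fun i => (Fin.cons x xs : Fin (n + 1) → X) (insertZero k σ i)).drop k =
      x :: (List.ofFn fun i => xs (σ i)).drop k := by
  refine List.ext_getElem (by simp; omega) fun i h1 h2 => ?_
  simp only [List.getElem_drop, List.getElem_ofFn, cons_insertZero]
  simp at h1 h2
  rcases i with _ | i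
  · simp
  · have : (⟨k + (i + 1), by omega⟩ : Fin (n + 1)) = k.succAbove ⟨k + i, by omega⟩ := by
      rw [Fin.succAbove_of_le_castSucc _ _ (by simp [Fin.le_def])]
      rfl
    rw [this, Fin.insertNth_apply_succAbove]
    simp

theorem inversionSign_insertZero (x : X) (xs : Fin n → X) (k : Fin (n + 1))
    (σ : Equiv.Perm (Fin n)) :
    inversionSign c (insertZero k σ) (Fin.cons x xs : Fin (n + 1) → X) =
      moveSign c x ((List.ofFn fun i => xs (σ i)).take k) * inversionSign c σ xs := by
  have h1 : moveSign c x ((List.ofFn fun i => xs (σ i)).take k) =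
      ∏ i : Fin n, if k.succAbove i < k then c x (xs (σ i)) else 1 := by
    rw [moveSign, List.map_take, List.map_ofFn, List.prod_take_ofFn, Finset.prod_filter]
    refine Finset.prod_congr rfl fun i _ => ?_
    simp only [Fin.succAbove_lt_iff_castSucc_lt, Function.comp]
    rfl
  rw [h1, inversionSign, Fin.prod_univ_succAbove _ k, Finset.prod_eq_one, one_mul, inversionSign,
    ← Finset.prod_mul_distrib]
  · refine Finset.prod_congr rfl fun i _ => ?_
    rw [Fin.prod_univ_succAbove _ k]
    simp [Fin.succAbove_lt_succAbove_iff]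
  · intro j _
    simp

/-- The unshuffle coproduct of a word as a sum over unshuffle permutations. -/
theorem unshuffleSum_ofFn (x : Fin n → X) (f : List X → List X → M) :
    unshuffleSum c (List.ofFn x) f = ∑ t : Fin (n + 1), ∑ σ ∈ unshuffles n t,
      inversionSign c σ x • f ((List.ofFn fun i => x (σ i)).take t)
        ((List.ofFn fun i => x (σ i)).drop t) := by
  induction n generalizing f with
  | zero =>
    have : unshuffles 0 0 = {1} := by decide
    simp [this, inversionSign]
  | succ n ih =>
    obtain ⟨x, xs, rfl⟩ : ∃ a as, x = Fin.cons a as :=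
      ⟨x 0, Fin.tail x, (Fin.cons_self_tail x).symm⟩
    have hw : List.ofFn (Fin.cons x xs : Fin (n + 1) → X) = x :: List.ofFn xs := by
      simp [List.ofFn_succ]
    rw [hw, unshuffleSum_cons, ih, ih, sum_unshuffles_succ fun t τ =>
      inversionSign c τ (Fin.cons x xs : Fin (n + 1) → X) •
        f ((List.ofFn fun i => (Fin.cons x xs : Fin (n + 1) → X) (τ i)).take t)
        ((List.ofFn fun i => (Fin.cons x xs : Fin (n + 1) → X) (τ i)).drop t)]
    congr 1
    · refine Finset.sum_congr rfl fun t _ => Finset.sum_congr rfl fun σ _ => ?_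
      rw [ofFn_insertZero_zero, inversionSign_insertZero]
      simp [moveSign]
    · refine Finset.sum_congr rfl fun t _ => Finset.sum_congr rfl fun σ _ => ?_
      rw [take_ofFn_insertZero, drop_ofFn_insertZero, inversionSign_insertZero, smul_smul, mul_comm]

/-- The part of the unshuffle coproduct in which the first letter stays in the first part, as a sum
over the unshuffles `τ` with `τ(1) < τ(t + 1)`. -/
theorem unshuffleSum_ofFn_minus (x : X) (xs : Fin n → X) (f : List X → List X → M)
    (hf : ∀ A, f A [] = 0) :
    unshuffleSum c (List.ofFn xs) (fun A B => f (x :: A) B) =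
      ∑ t ∈ Finset.Ico 1 (n + 1), ∑ τ ∈ unshufflesMinus (n + 1) t,
      inversionSign c τ (Fin.cons x xs : Fin (n + 1) → X) •
        f ((List.ofFn fun i => (Fin.cons x xs : Fin (n + 1) → X) (τ i)).take t)
        ((List.ofFn fun i => (Fin.cons x xs : Fin (n + 1) → X) (τ i)).drop t) := by
  rw [unshuffleSum_ofFn, sum_unshufflesMinus fun t τ =>
      inversionSign c τ (Fin.cons x xs : Fin (n + 1) → X) •
        f ((List.ofFn fun i => (Fin.cons x xs : Fin (n + 1) → X) (τ i)).take t)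
        ((List.ofFn fun i => (Fin.cons x xs : Fin (n + 1) → X) (τ i)).drop t),
    Fin.sum_univ_castSucc, ← Fin.sum_univ_eq_sum_range fun t => ∑ σ ∈ unshuffles n t,
      inversionSign c (insertZero 0 σ) (Fin.cons x xs : Fin (n + 1) → X) •
        f ((List.ofFn fun i => (Fin.cons x xs : Fin (n + 1) → X) (insertZero 0 σ i)).take (t + 1))
        ((List.ofFn fun i => (Fin.cons x xs : Fin (n + 1) → X) (insertZero 0 σ i)).drop (t + 1))]
  rw [Finset.sum_eq_zero (s := unshuffles n _) fun σ _ => by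
    rw [List.drop_of_length_le (by simp), hf, smul_zero], add_zero]
  refine Finset.sum_congr rfl fun t _ => Finset.sum_congr rfl fun σ _ => ?_
  rw [ofFn_insertZero_zero, inversionSign_insertZero]
  simp [moveSign]

/-- A function of words that is graded symmetric under exchanges of adjacent letters is graded
symmetric under all permutations. -/
theorem AdjSymmetric.perm {g : List X → M} (hg : AdjSymmetric c n g)
    (hc : ∀ x y, c x y = c y x) (σ : Equiv.Perm (Fin n)) (x : Fin n → X) :
    g (List.ofFn fun i => x (σ i)) = inversionSign c σ x • g (List.ofFn x) := by
  have move : ∀ {n : ℕ} {g : List X → M}, AdjSymmetric c n g → ∀ (x : X) (A B : List X),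
      (A ++ x :: B).length = n → g (A ++ x :: B) = moveSign c x A • g (x :: (A ++ B)) := by
    intro n g hg x A
    induction A generalizing n g with
    | nil => intro B _; simp [moveSign]
    | cons a A ih =>
      intro B hn
      obtain ⟨n, rfl⟩ : ∃ m, n = m + 1 := ⟨_, hn.symm⟩
      have h1 := ih (hg.cons a) B (by simpa using hn)
      have h2 := hg [] a x (A ++ B) (by simp at hn ⊢; omega)
      have h3 : moveSign c x (a :: A) = c x a * moveSign c x A := by simp [moveSign]
      rw [List.nil_append, List.nil_append] at h2
      rw [List.cons_append, h1, h2, h3, smul_smul, hc, mul_comm, List.cons_append]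
  induction n generalizing g with
  | zero => simp [inversionSign]
  | succ n ih =>
    obtain ⟨x, xs, rfl⟩ : ∃ a as, x = Fin.cons a as :=
      ⟨x 0, Fin.tail x, (Fin.cons_self_tail x).symm⟩
    obtain ⟨k, σ, rfl⟩ := exists_insertZero σ
    have hw : List.ofFn (Fin.cons x xs : Fin (n + 1) → X) = x :: List.ofFn xs := by
      simp [List.ofFn_succ]
    rw [← List.take_append_drop k (List.ofFn fun i => _), take_ofFn_insertZero,
      drop_ofFn_insertZero, move hg _ _ _ (by simp; omega), List.take_append_drop,
      ih (hg.cons x), inversionSign_insertZero, smul_smul, hw]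

end Unshuffles

/-! ### Evaluation of multilinear maps on words of homogeneous elements -/

theorem two_eq_zero : (2 : ZMod 2) = 0 := rfl

section Evaluation

variable {𝕜 B W : Type*} [Field 𝕜] [AddCommGroup B] [Module 𝕜 B] [AddCommGroup W] [Module 𝕜 W]

/-- A homogeneous element of a graded vector space, together with its degree. -/
structure Letter (𝓑 : ℤ → Submodule 𝕜 B) where
  /-- the degree -/
  deg : ℤ
  /-- the underlying element -/
  val : B
  mem : val ∈ 𝓑 deg

variable {𝓑 : ℤ → Submodule 𝕜 B}

/-- The parity of a homogeneous element after the shift of degrees by one. -/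
def Letter.par (x : Letter 𝓑) : ZMod 2 := (x.deg : ZMod 2) + 1

/-- The sum of the shifted degrees `deg x - 1` of the letters of a word. -/
def shiftedDeg (L : List (Letter 𝓑)) : ℤ := (L.map fun x => x.deg - 1).sum

@[simp] theorem shiftedDeg_cons (x : Letter 𝓑) (L : List (Letter 𝓑)) :
    shiftedDeg (x :: L) = x.deg - 1 + shiftedDeg L := by simp [shiftedDeg]

theorem coe_shiftedDeg (L : List (Letter 𝓑)) :
    ((shiftedDeg L : ℤ) : ZMod 2) = wordParity Letter.par L := by
  induction L with
  | nil => simp [shiftedDeg]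
  | cons x L ih =>
    rw [shiftedDeg_cons, wordParity_cons, ← ih, Letter.par]
    push_cast
    linear_combination -two_eq_zero

theorem sum_deg (L : List (Letter 𝓑)) : (L.map Letter.deg).sum = shiftedDeg L + L.length := by
  induction L with
  | nil => simp [shiftedDeg]
  | cons x L ih => simp [ih]; ring

theorem coe_sum_deg (L : List (Letter 𝓑)) :
    (((L.map Letter.deg).sum : ℤ) : ZMod 2) = wordParity Letter.par L + L.length := by
  rw [sum_deg, Int.cast_add, coe_shiftedDeg, Int.cast_natCast]

/-- The exponent of the décalage sign of a word `x₁ ⋯ xₙ`, which is `∑ (n - i) deg xᵢ`. -/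
def decalage : List (Letter 𝓑) → ZMod 2
  | [] => 0
  | x :: L => x.deg * L.length + decalage L

@[simp] theorem decalage_nil : decalage ([] : List (Letter 𝓑)) = 0 := rfl

@[simp] theorem decalage_cons (x : Letter 𝓑) (L : List (Letter 𝓑)) :
    decalage (x :: L) = x.deg * L.length + decalage L := rfl

theorem decalage_append (A L : List (Letter 𝓑)) : decalage (A ++ L) =
    decalage A + decalage L + (wordParity Letter.par A + A.length) * L.length := by
  induction A with
  | nil => simp
  | cons x A ih =>
    simp only [List.cons_append, decalage_cons, ih, List.length_append, wordParity_cons,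
      Letter.par, List.length_cons]
    push_cast
    generalize (x.deg : ZMod 2) = a, decalage A = b, decalage L = d,
      wordParity _ A = e
    generalize (A.length : ZMod 2) = f, (L.length : ZMod 2) = g
    linear_combination (-g : ZMod 2) * two_eq_zero

/-- The commutation factor `-(-1)^{|x||y|}` of unshifted degrees. -/
def chiFactor (x y : Letter 𝓑) : ℤ := - eps (x.deg * y.deg)

theorem chiFactor_comm (x y : Letter 𝓑) : chiFactor x y = chiFactor y x := by
  rw [chiFactor, chiFactor, mul_comm]

/-- The décalage signs turn the unshifted commutation factor into the shifted one. -/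
theorem decalage_swap (P Q : List (Letter 𝓑)) (x y : Letter 𝓑) :
    eps (decalage (P ++ x :: y :: Q)) * koszulFactor Letter.par x y =
      eps (decalage (P ++ y :: x :: Q)) * chiFactor x y := by
  simp only [decalage_append, decalage_cons, koszulFactor, chiFactor, Letter.par,
    List.length_cons]
  push_cast
  generalize (x.deg : ZMod 2) = a, (y.deg : ZMod 2) = b, decalage P = d, decalage Q = e
  generalize ((wordParity _ P : ZMod 2) + (P.length : ZMod 2)) * _ = f
  generalize (Q.length : ZMod 2) = g
  have h : ∀ a b z g : ZMod 2, eps (z + (a * (g + 1) + b * g)) * eps ((a + 1) * (b + 1)) =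
      eps (z + (b * (g + 1) + a * g)) * - eps (a * b) := by decide
  convert h a b (d + e + f) g using 3 <;> ring

/-- Unshifted and shifted signs in the unshuffle coproduct differ by the décalage signs. -/
theorem unshuffleSum_chiFactor {M : Type*} [AddCommGroup M] (L : List (Letter 𝓑))
    (f : List (Letter 𝓑) → List (Letter 𝓑) → M) :
    eps (decalage L) • unshuffleSum chiFactor L f =
      unshuffleSum (koszulFactor Letter.par) L fun A D => eps (decalage (A ++ D)) • f A D := by
  induction L generalizing f with
  | nil => rfl
  | cons x L ih =>
    rw [unshuffleSum_cons, unshuffleSum_cons, smul_add, decalage_cons, eps_add, mul_smul, ih,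
      mul_smul, ih, ← unshuffleSum_smul, ← unshuffleSum_smul]
    have hmove : ∀ A : List (Letter 𝓑), moveSign chiFactor x A =
        eps (x.deg * wordParity Letter.par A + (x.deg + 1) * A.length) := by
      intro A
      induction A with
      | nil => simp [moveSign]
      | cons a A ih' =>
        have : moveSign chiFactor x (a :: A) = chiFactor x a * moveSign chiFactor x A := by
          simp [moveSign]
        rw [this, ih', chiFactor, wordParity_cons, List.length_cons, Letter.par]
        push_cast
        generalize (x.deg : ZMod 2) = a, (a.deg : ZMod 2) = b, wordParity _ A = d
        generalize (A.length : ZMod 2) = f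
        revert a b d f
        decide
    congr 1 <;> refine unshuffleSum_congr _ fun A D h => ?_
    · rw [List.cons_append, decalage_cons, smul_smul, ← eps_add, h.length_eq]
    · rw [hmove, moveSign_koszulFactor, smul_smul, smul_smul, smul_smul, ← eps_add, ← eps_add,
        ← eps_add, ← h.length_eq, decalage_append, decalage_append, decalage_cons,
        List.length_cons, List.length_append, Letter.par]
      congr 2
      push_cast
      generalize (x.deg : ZMod 2) = a, decalage A = b, decalage D = d, wordParity _ A = e
      generalize (A.length : ZMod 2) = f, (D.length : ZMod 2) = g
      linear_combination (a * f - e) * two_eq_zero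

theorem inversionSign_chiFactor {n : ℕ} (σ : Equiv.Perm (Fin n)) (x : Fin n → Letter 𝓑) :
    inversionSign chiFactor σ x = ((chi σ fun i => (x i).deg : ℤˣ) : ℤ) := by
  have h1 : ((Equiv.Perm.sign σ : ℤˣ) : ℤ) =
      ∏ i, ∏ j, if i < j ∧ σ j < σ i then (-1 : ℤ) else 1 := by
    rw [Equiv.Perm.sign_eq_prod_prod_Ioi, Units.coe_prod]
    refine Finset.prod_congr rfl fun i _ => ?_
    rw [Units.coe_prod, ← Finset.filter_lt_eq_Ioi, Finset.prod_filter]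
    refine Finset.prod_congr rfl fun j _ => ?_
    by_cases hij : i < j
    · have hne : σ i ≠ σ j := fun h => hij.ne (σ.injective h)
      rcases lt_or_gt_of_ne hne with h | h
      · simp [hij, h, h.not_gt]
      · simp [hij, h, h.not_gt]
    · simp [hij]
  have h2 : ((koszulSign σ fun i => (x i).deg : ℤˣ) : ℤ) = ∏ i, ∏ j, if i < j ∧ σ j < σ i then
      eps ((x (σ j)).deg * (x (σ i)).deg) else 1 := by
    rw [koszulSign, Units.coe_prod, Finset.prod_filter, Fintype.prod_prod_type]
    refine Finset.prod_congr rfl fun i _ => Finset.prod_congr rfl fun j _ => ?_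
    rw [coe_negOnePow, Int.cast_mul, mul_comm]
  rw [chi, Units.val_mul, h1, h2, ← Finset.prod_mul_distrib, inversionSign]
  refine Finset.prod_congr rfl fun i _ => ?_
  rw [← Finset.prod_mul_distrib]
  refine Finset.prod_congr rfl fun j _ => ?_
  split_ifs <;> simp [chiFactor]

/-- The value of the family `m` of multilinear maps on a word, the first letter of which is
replaced by `b` and the others form the word `L`. -/
def evalFirst (m : (n : ℕ) → MultilinearMap 𝕜 (fun _ : Fin n => B) W) (L : List (Letter 𝓑)) :
    B →ₗ[𝕜] W where
  toFun b := m (L.length + 1) (Fin.cons b fun i => (L.get i).val)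
  map_add' _ _ := MultilinearMap.cons_add _ _ _ _
  map_smul' _ _ := MultilinearMap.cons_smul _ _ _ _

/-- The value of a family of multilinear maps on a word. -/
def evalWord (m : (n : ℕ) → MultilinearMap 𝕜 (fun _ : Fin n => B) W) (L : List (Letter 𝓑)) : W :=
  m L.length fun i => (L.get i).val

/-- The value of a family of multilinear maps on a word, with the décalage sign. -/
def shiftedEval (m : (n : ℕ) → MultilinearMap 𝕜 (fun _ : Fin n => B) W) (L : List (Letter 𝓑)) :
    W :=
  eps (decalage L) • evalWord m L

variable (m : (n : ℕ) → MultilinearMap 𝕜 (fun _ : Fin n => B) W)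

theorem evalWord_cons (x : Letter 𝓑) (L : List (Letter 𝓑)) :
    evalWord m (x :: L) = evalFirst m L x.val := by
  refine congrArg (m (L.length + 1)) (funext fun i => ?_)
  refine Fin.cases ?_ (fun i => ?_) i <;> simp

theorem evalWord_ofFn {n : ℕ} (x : Fin n → Letter 𝓑) :
    evalWord m (List.ofFn x) = m n fun i => (x i).val := by
  have h : ∀ (L : List (Letter 𝓑)) (hL : L.length = n) (hx : ∀ i, L.get (Fin.cast hL.symm i) = x i),
      evalWord m L = m n fun i => (x i).val := by
    rintro L rfl hx
    exact congrArg _ (funext fun i => by rw [← hx i]; rfl)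
  exact h _ (by simp) (by simp)

theorem evalFirst_ofFn {n : ℕ} (b : B) (x : Fin n → Letter 𝓑) :
    evalFirst m (List.ofFn x) b = m (n + 1) (Fin.cons b fun i => (x i).val) := by
  have h : ∀ (L : List (Letter 𝓑)) (hL : L.length = n) (hx : ∀ i, L.get (Fin.cast hL.symm i) = x i),
      evalFirst m L b = m (n + 1) (Fin.cons b fun i => (x i).val) := by
    rintro L rfl hx
    refine congrArg (m (L.length + 1)) ?_
    congr 1
    exact funext fun i => by rw [← hx i]; rfl
  exact h _ (by simp) (by simp)

theorem shiftedEval_cons (x : Letter 𝓑) (L : List (Letter 𝓑)) : shiftedEval m (x :: L) =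
    eps (x.deg * L.length + decalage L) • evalFirst m L x.val := by
  rw [shiftedEval, evalWord_cons, decalage_cons]

theorem evalWord_eq (L : List (Letter 𝓑)) :
    evalWord m L = eps (decalage L) • shiftedEval m L := by
  rw [shiftedEval, smul_smul, eps_mul_self, one_smul]

theorem shiftedEval_mem {𝓦 : ℤ → Submodule 𝕜 W} {e : ℤ} (hm : ∀ n, HasDegree 𝓑 𝓦 (m n) (e - n))
    (L : List (Letter 𝓑)) : shiftedEval m L ∈ 𝓦 (shiftedDeg L + e) := by
  refine zsmul_mem ?_ _
  have h := hm L.length (fun i => (L.get i).deg) (fun i => (L.get i).val) fun i => (L.get i).mem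
  have h2 : ∑ i, (L.get i).deg = shiftedDeg L + L.length := by
    rw [← sum_deg, ← List.sum_ofFn]
    exact congrArg List.sum (List.ofFn_getElem_eq_map L Letter.deg)
  rw [h2, add_add_sub_cancel] at h
  exact h

/-- Graded symmetry on words with respect to shifted degrees is skew symmetry. -/
theorem isSkew_of_adjSymmetric {n : ℕ}
    (h : AdjSymmetric (koszulFactor (Letter.par (𝓑 := 𝓑))) n (shiftedEval m)) :
    IsSkew 𝓑 (m n) := by
  intro σ d v hv
  have h1 : AdjSymmetric chiFactor n (evalWord (𝓑 := 𝓑) m) := by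
    intro P x y Q hn
    rw [evalWord_eq, h P x y Q hn, smul_smul, decalage_swap, mul_comm, mul_smul, ← evalWord_eq]
  have h2 := h1.perm _ chiFactor_comm σ fun i => ⟨d i, v i, hv i⟩
  rw [evalWord_ofFn, evalWord_ofFn, inversionSign_chiFactor] at h2
  exact h2

theorem take_ofFn {X : Type*} {n t : ℕ} (ht : t ≤ n) (x : Fin n → X) :
    (List.ofFn x).take t = List.ofFn fun i => x (firstIdx ht i) := by
  refine List.ext_getElem (by simpa using ht) fun i h1 h2 => ?_
  simp [firstIdx]

theorem drop_ofFn {X : Type*} {n : ℕ} (t : ℕ) (x : Fin n → X) :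
    (List.ofFn x).drop t = List.ofFn fun i => x (lastIdx t i) := by
  refine List.ext_getElem (by simp) fun i h1 h2 => ?_
  simp [lastIdx]

theorem sum_firstIdx_add_sum_lastIdx {n t : ℕ} (ht : t ≤ n) (τ : Equiv.Perm (Fin n))
    (d : Fin n → ℤ) :
    ∑ i, d (τ (firstIdx ht i)) + ∑ i : Fin (n - t), d (τ (lastIdx t i)) = ∑ i, d i := by
  have h : Function.Bijective (Sum.elim (firstIdx ht) (lastIdx (n := n) t)) := by
    refine ⟨(firstIdx_injective ht).sumElim lastIdx_injective (firstIdx_ne_lastIdx ht), fun a => ?_⟩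
    rcases exists_idx ht a with ⟨i, rfl⟩ | ⟨i, rfl⟩
    · exact ⟨Sum.inl i, rfl⟩
    · exact ⟨Sum.inr i, rfl⟩
  rw [← Equiv.sum_comp τ d, ← Equiv.sum_comp (Equiv.ofBijective _ h), Fintype.sum_sum_type]
  rfl

theorem units_smul_mem (S : Submodule 𝕜 W) (z : ℤˣ)
    {x : W} (hx : x ∈ S) : z • x ∈ S := by
  rw [Units.smul_def]
  exact zsmul_mem hx _

theorem coe_shiftedDeg_add_one (L : List (Letter 𝓑)) :
    ((shiftedDeg L + 1 : ℤ) : ZMod 2) = wordParity Letter.par L + 1 := by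
  rw [Int.cast_add, coe_shiftedDeg, Int.cast_one]

theorem exists_ofFn {α : Type*} (L : List α) : ∃ (n : ℕ) (x : Fin n → α), L = List.ofFn x :=
  ⟨_, L.get, (List.ofFn_get L).symm⟩

theorem shiftedEval_eq_zero_of_mem {x : Letter 𝓑} (hx : x.val = 0)
    {L : List (Letter 𝓑)} (h : x ∈ L) : shiftedEval m L = 0 := by
  obtain ⟨i, rfl⟩ := List.get_of_mem h
  rw [shiftedEval, evalWord, MultilinearMap.map_coord_zero _ i hx, smul_zero]

variable (q : (n : ℕ) → MultilinearMap 𝕜 (fun _ : Fin n => B) B)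

/-- The value of an operation of degree `2 - n` on a word, as a letter. -/
def insertLetter (hq : ∀ n : ℕ, HasDegree 𝓑 𝓑 (q n) (2 - n)) (A : List (Letter 𝓑)) : Letter 𝓑 where
  deg := shiftedDeg A + 2
  val := shiftedEval q A
  mem := shiftedEval_mem q hq A

theorem insertLetter_par (hq : ∀ n : ℕ, HasDegree 𝓑 𝓑 (q n) (2 - n)) (A : List (Letter 𝓑)) :
    (insertLetter q hq A).par = wordParity Letter.par A + 1 := by
  simp only [Letter.par, insertLetter]
  push_cast
  rw [coe_shiftedDeg, two_eq_zero, add_zero]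

theorem shiftedEval_insertLetter (hq : ∀ n : ℕ, HasDegree 𝓑 𝓑 (q n) (2 - n))
    (A L : List (Letter 𝓑)) : shiftedEval m (insertLetter q hq A :: L) =
      eps (wordParity Letter.par A * L.length + decalage L) •
        evalFirst m L (shiftedEval q A) := by
  rw [shiftedEval_cons]
  simp only [insertLetter]
  push_cast
  rw [coe_shiftedDeg, two_eq_zero, add_zero]

/-- The sums of insertions over unshuffles, in terms of the unshuffle coproduct. -/
theorem sum_insertPerm (hq : ∀ n : ℕ, HasDegree 𝓑 𝓑 (q n) (2 - n)) (a : ℕ) {n : ℕ} (d : Fin n → ℤ)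
    (v : Fin n → B) (hv : ∀ i, v i ∈ 𝓑 (d i)) :
    eps (decalage (List.ofFn fun i => (⟨d i, v i, hv i⟩ : Letter 𝓑))) •
      ∑ k : Finset.Icc a n, ∑ σ ∈ unshuffles n k,
        (((k : ℤ) * ((n : ℤ) - k)).negOnePow * chi σ d) •
          insertPerm (Finset.mem_Icc.1 k.2).2 (m (n - k + 1)) (q k) σ v =
    unshuffleSum (koszulFactor Letter.par) (List.ofFn fun i => (⟨d i, v i, hv i⟩ : Letter 𝓑))
      fun A D => if a ≤ A.length then shiftedEval m (insertLetter q hq A :: D) else 0 := by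
  set x : Fin n → Letter 𝓑 := fun i => ⟨d i, v i, hv i⟩ with hx
  set f : List (Letter 𝓑) → List (Letter 𝓑) → W := fun A D =>
    if a ≤ A.length then eps (A.length * D.length) • evalFirst m D (evalWord q A) else 0 with hf
  have h1 : ∀ k : Finset.Icc a n, ∑ σ ∈ unshuffles n k,
        (((k : ℤ) * ((n : ℤ) - k)).negOnePow * chi σ d) •
          insertPerm (Finset.mem_Icc.1 k.2).2 (m (n - k + 1)) (q k) σ v =
      ∑ σ ∈ unshuffles n k, inversionSign chiFactor σ x •
        f ((List.ofFn fun i => x (σ i)).take k) ((List.ofFn fun i => x (σ i)).drop k) := by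
    intro k
    refine Finset.sum_congr rfl fun σ _ => ?_
    have hk := Finset.mem_Icc.1 k.2
    have hlen : (((n - k : ℕ) : ℤ) : ZMod 2) = (((n : ℤ) - k : ℤ) : ZMod 2) := by
      rw [Nat.cast_sub hk.2]
    rw [inversionSign_chiFactor, take_ofFn hk.2, drop_ofFn, hf]
    simp only [List.length_ofFn, hk.1, if_true]
    rw [evalFirst_ofFn, evalWord_ofFn, smul_smul, Units.smul_def, Units.val_mul, coe_negOnePow,
      mul_comm, Int.cast_mul, ← hlen]
    simp only [Int.cast_natCast]
    rfl
  rw [Finset.sum_congr rfl fun k _ => h1 k, Finset.sum_coe_sort (Finset.Icc a n) fun k =>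
    ∑ σ ∈ unshuffles n k, inversionSign chiFactor σ x •
        f ((List.ofFn fun i => x (σ i)).take k) ((List.ofFn fun i => x (σ i)).drop k)]
  have h2 : ∑ k ∈ Finset.Icc a n, ∑ σ ∈ unshuffles n k, inversionSign chiFactor σ x •
        f ((List.ofFn fun i => x (σ i)).take k) ((List.ofFn fun i => x (σ i)).drop k) =
      unshuffleSum chiFactor (List.ofFn x) f := by
    rw [unshuffleSum_ofFn, Fin.sum_univ_eq_sum_range fun k => ∑ σ ∈ unshuffles n k,
      inversionSign chiFactor σ x •
        f ((List.ofFn fun i => x (σ i)).take k) ((List.ofFn fun i => x (σ i)).drop k)]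
    refine Finset.sum_subset (fun k hk => ?_) fun k hk hk' => Finset.sum_eq_zero fun σ _ => ?_
    · simp at hk ⊢; omega
    · rw [hf]
      simp only [List.length_take, List.length_ofFn]
      rw [if_neg, smul_zero]
      simp at hk hk' ⊢; omega
  rw [h2, unshuffleSum_chiFactor]
  refine unshuffleSum_congr _ fun A D _ => ?_
  rw [hf]
  simp only
  split_ifs with ha
  · rw [shiftedEval_insertLetter, shiftedEval, map_zsmul, smul_smul, smul_smul, ← eps_add,
      ← eps_add, decalage_append]
    congr 2
    generalize decalage A = b, decalage D = d, wordParity _ A = e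
    generalize (A.length : ZMod 2) = f, (D.length : ZMod 2) = g
    linear_combination (f * g) * two_eq_zero
  · rw [smul_zero]

/-- The sums of brackets over unshuffles `τ` with `τ(1) < τ(t + 1)`, in terms of the unshuffle
coproduct of the word without its first letter: in such an unshuffle the first letter stays in the
first part. -/
theorem sum_bracketPerm (br : W →ₗ[𝕜] W →ₗ[𝕜] W) (hm : m 0 = 0) {n : ℕ} (d : Fin (n + 1) → ℤ)
    (v : Fin (n + 1) → B) (hv : ∀ i, v i ∈ 𝓑 (d i)) :
    eps (decalage (List.ofFn fun i => (⟨d i, v i, hv i⟩ : Letter 𝓑))) •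
      ∑ t : Finset.Ico 1 (n + 1), ∑ τ ∈ unshufflesMinus (n + 1) t, (chi τ d * kappa τ t d) •
        br (m t fun i => v (τ (firstIdx (Finset.mem_Ico.1 t.2).2.le i)))
          (m (n + 1 - t) fun i => v (τ (lastIdx t i))) =
    unshuffleSum (koszulFactor Letter.par)
      (List.ofFn fun i : Fin n => (⟨d i.succ, v i.succ, hv i.succ⟩ : Letter 𝓑))
      fun A D => eps (Letter.par (⟨d 0, v 0, hv 0⟩ : Letter 𝓑) + wordParity Letter.par A + 1) •
        br (shiftedEval m ((⟨d 0, v 0, hv 0⟩ : Letter 𝓑) :: A)) (shiftedEval m D) := by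
  set x : Fin (n + 1) → Letter 𝓑 := fun i => ⟨d i, v i, hv i⟩ with hx
  set f : List (Letter 𝓑) → List (Letter 𝓑) → W := fun A D =>
    eps (A.length + 1 + (D.length + 1) * (A.map Letter.deg).sum) •
      br (evalWord m A) (evalWord m D) with hf
  have h1 : ∀ t : Finset.Ico 1 (n + 1), ∑ τ ∈ unshufflesMinus (n + 1) t,
        (chi τ d * kappa τ t d) •
          br (m t fun i => v (τ (firstIdx (Finset.mem_Ico.1 t.2).2.le i)))
            (m (n + 1 - t) fun i => v (τ (lastIdx t i))) =
      ∑ τ ∈ unshufflesMinus (n + 1) t, inversionSign chiFactor τ x •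
        f ((List.ofFn fun i => x (τ i)).take t) ((List.ofFn fun i => x (τ i)).drop t) := by
    intro t
    refine Finset.sum_congr rfl fun τ _ => ?_
    have ht := Finset.mem_Ico.1 t.2
    have hlen : (((n + 1 - t : ℕ) : ℤ) : ZMod 2) = ((((n + 1 : ℕ) : ℤ) - t : ℤ) : ZMod 2) := by
      rw [Nat.cast_sub ht.2.le]
    have hdeg : (((List.ofFn fun i => x (τ i)).take t).map Letter.deg).sum =
        ∑ p : Fin (n + 1) with p.val < t.val, d (τ p) := by
      rw [List.map_take, List.map_ofFn, List.sum_take_ofFn]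
      rfl
    rw [inversionSign_chiFactor, hf]
    simp only [hdeg]
    rw [take_ofFn ht.2.le, drop_ofFn]
    simp only [List.length_ofFn]
    rw [evalWord_ofFn, evalWord_ofFn, smul_smul, Units.smul_def, Units.val_mul, kappa,
      coe_negOnePow]
    congr 2
    have h11 : (-1 : ZMod 2) = 1 := by decide
    have h3 : ((n + 1 - t : ℕ) : ZMod 2) = (((n + 1 : ℕ) : ℤ) - t : ℤ) := by
      rw [← hlen, Int.cast_natCast]
    rw [h3]
    push_cast
    simp only [sub_eq_add_neg, h11]
  rw [Finset.sum_congr rfl fun k _ => h1 k, Finset.sum_coe_sort (Finset.Ico 1 (n + 1)) fun t =>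
    ∑ τ ∈ unshufflesMinus (n + 1) t, inversionSign chiFactor τ x •
        f ((List.ofFn fun i => x (τ i)).take t) ((List.ofFn fun i => x (τ i)).drop t)]
  have hx0 : x = Fin.cons (x 0) fun i => x i.succ := (Fin.cons_self_tail x).symm
  have h2 := unshuffleSum_ofFn_minus chiFactor (x 0) (fun i => x i.succ) f fun A => by
    have : evalWord m ([] : List (Letter 𝓑)) = 0 := by
      show m 0 _ = 0
      rw [hm]; rfl
    rw [hf]
    simp only [this, map_zero, smul_zero]
  rw [← hx0] at h2
  rw [← h2, List.ofFn_succ, decalage_cons, eps_add, mul_smul, unshuffleSum_chiFactor,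
    ← unshuffleSum_smul]
  refine unshuffleSum_congr _ fun A D h => ?_
  change _ = eps ((x 0).par + _ + 1) • br (shiftedEval m (x 0 :: A)) _
  rw [hf, shiftedEval, shiftedEval, bracket_zsmul_left, bracket_zsmul_right]
  simp only [smul_smul]
  simp only [← eps_add]
  congr 2
  rw [coe_sum_deg, decalage_append, decalage_cons, ← h.length_eq, List.length_append,
    wordParity_cons, List.length_cons, Letter.par]
  push_cast
  generalize ((x 0).deg : ZMod 2) = a, decalage A = b, decalage D = d, wordParity _ A = e
  generalize (A.length : ZMod 2) = f, (D.length : ZMod 2) = g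
  linear_combination (1 + a * g + f + f * g + g + g * e) * two_eq_zero

end Evaluation

/-! ### Degrees of the transferred operations -/

namespace Contraction

variable {𝕜 B C : Type*} [Field 𝕜] [AddCommGroup B] [Module 𝕜 B] [AddCommGroup C] [Module 𝕜 C]
  {𝓑 : ℤ → Submodule 𝕜 B} [DirectSum.Decomposition 𝓑] {𝓒 : ℤ → Submodule 𝕜 C}
  {X : CochainStructure 𝓑} {Y : DGLieStructure 𝓒} (R : Contraction X Y.toCochainStructure)

theorem φ_zero : R.φ 0 = 0 := by rw [φ]

theorem v_zero (f : Fin 0 → B) : R.v 0 f = 0 := by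
  rw [v_apply R 0 (fun _ => 0) f fun i => i.elim0]
  exact Finset.sum_eq_zero fun t _ => absurd (Finset.mem_Ico.1 t.2) (by omega)

theorem hasDegree_v {n : ℕ} (h : ∀ m < n, HasDegree 𝓑 𝓒 (R.φ m) (1 - m)) :
    HasDegree 𝓑 𝓒 (R.v n) (2 - n) := by
  intro d f hf
  rw [v_apply R n d f hf]
  refine Submodule.sum_mem _ fun t _ => Submodule.sum_mem _ fun τ _ => units_smul_mem _ _ ?_
  have ht := Finset.mem_Ico.1 t.2
  have h1 := h t ht.2 (fun i => d (τ (firstIdx ht.2.le i))) _ fun i => hf (τ (firstIdx ht.2.le i))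
  have h2 := h (n - t) (by omega) (fun i => d (τ (lastIdx t i))) _ fun i => hf (τ (lastIdx t i))
  have h3 := Y.bracket_mem _ _ _ _ h1 h2
  convert h3 using 2
  rw [← sum_firstIdx_add_sum_lastIdx ht.2.le τ d, Nat.cast_sub ht.2.le]
  ring

theorem hasDegree_l_of_v {n : ℕ} (h : HasDegree 𝓑 𝓒 (R.v n) (2 - n)) :
    HasDegree 𝓑 𝓑 (R.l n) (2 - n) := by
  intro d f hf
  rcases n with _ | _ | n
  · exact Submodule.zero_mem _
  · have := X.d_mem _ _ (hf 0)
    change X.d (f 0) ∈ _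
    convert this using 2
    simp
  · rw [l_apply R _ (by omega)]
    exact R.F_mem _ _ (h d f hf)

theorem hasDegree_u {n : ℕ} (h : ∀ m < n, HasDegree 𝓑 𝓒 (R.φ m) (1 - m))
    (hl : ∀ m ≤ n, HasDegree 𝓑 𝓑 (R.l m) (2 - m)) : HasDegree 𝓑 𝓒 (R.u n) (2 - n) := by
  intro d f hf
  rw [u_apply R n d f hf]
  refine Submodule.sum_mem _ fun k _ => Submodule.sum_mem _ fun τ _ => units_smul_mem _ _ ?_
  have hk := Finset.mem_Icc.1 k.2
  have h1 := hl k hk.2 (fun i => d (τ (firstIdx hk.2 i))) _ fun i => hf (τ (firstIdx hk.2 i))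
  have h2 := h (n - k + 1) (by omega) (Fin.cons _ fun i => d (τ (lastIdx k i)))
    (Fin.cons _ fun i => f (τ (lastIdx k i))) (Fin.cases h1 fun i => hf (τ (lastIdx k i)))
  convert h2 using 2
  rw [Fin.sum_univ_succ, ← sum_firstIdx_add_sum_lastIdx hk.2 τ d]
  simp only [Fin.cons_zero, Fin.cons_succ]
  push_cast [Nat.cast_sub hk.2]
  ring

theorem hasDegree_φ (n : ℕ) : HasDegree 𝓑 𝓒 (R.φ n) (1 - n) := by
  induction n using Nat.strong_induction_on with
  | _ n ih =>
    intro d f hf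
    rcases n with _ | _ | n
    · rw [φ_zero]
      exact Submodule.zero_mem _
    · have h : f = ![f 0] := by
        ext i
        exact Fin.cases rfl (fun j => j.elim0) i
      rw [h, φ_one]
      convert R.G_mem _ _ (hf 0) using 2
      simp
    · rw [φ_apply R _ (by omega)]
      have hv := R.hasDegree_v ih d f hf
      have hu := R.hasDegree_u ih (fun m hm => R.hasDegree_l_of_v <|
        R.hasDegree_v fun k hk => ih k (by omega)) d f hf
      convert R.H_mem _ _ (Submodule.add_mem _ hu hv) using 2
      ring

theorem hasDegree_l (n : ℕ) : HasDegree 𝓑 𝓑 (R.l n) (2 - n) :=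
  R.hasDegree_l_of_v (R.hasDegree_v fun m _ => R.hasDegree_φ m)

/-! ### The recursion on words -/

/-- The operations `lₙ` on words, with décalage signs. -/
noncomputable def lWord (L : List (Letter 𝓑)) : B := shiftedEval R.l L

/-- The maps `φₙ` on words, with décalage signs. -/
noncomputable def φWord (L : List (Letter 𝓑)) : C := shiftedEval R.φ L

/-- The maps `vₙ` on words, with décalage signs. -/
noncomputable def vWord (L : List (Letter 𝓑)) : C := shiftedEval R.v L

/-- The maps `uₙ` on words, with décalage signs. -/
noncomputable def uWord (L : List (Letter 𝓑)) : C := shiftedEval R.u L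

/-- The value of the operation `lₙ` on a word, as a letter. -/
noncomputable def lLetter (A : List (Letter 𝓑)) : Letter 𝓑 := insertLetter R.l R.hasDegree_l A

theorem lLetter_par (A : List (Letter 𝓑)) :
    (R.lLetter A).par = wordParity Letter.par A + 1 := insertLetter_par _ _ _

theorem φWord_mem (L : List (Letter 𝓑)) : R.φWord L ∈ 𝓒 (shiftedDeg L + 1) :=
  shiftedEval_mem R.φ R.hasDegree_φ L

theorem φWord_nil : R.φWord ([] : List (Letter 𝓑)) = 0 := by
  rw [φWord, shiftedEval]
  change _ • R.φ 0 _ = 0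
  rw [φ_zero, _root_.zero_apply, smul_zero]

theorem lWord_nil : R.lWord ([] : List (Letter 𝓑)) = 0 := by
  rw [lWord, shiftedEval]
  exact smul_zero _

theorem vWord_nil : R.vWord ([] : List (Letter 𝓑)) = 0 := by
  rw [vWord, shiftedEval]
  change _ • R.v 0 _ = 0
  rw [v_zero, smul_zero]

theorem φWord_singleton (x : Letter 𝓑) : R.φWord [x] = R.G x.val := by
  rw [φWord, shiftedEval, ← φ_one]
  simp only [decalage_cons, decalage_nil, List.length_nil, Nat.cast_zero, mul_zero, add_zero,
    eps_zero, one_smul]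
  refine congrArg (R.φ 1) (funext fun i => ?_)
  match i with
  | ⟨0, _⟩ => rfl

theorem lWord_singleton (x : Letter 𝓑) : R.lWord [x] = X.d x.val := by
  rw [lWord, shiftedEval]
  simp only [decalage_cons, decalage_nil, List.length_nil, Nat.cast_zero, mul_zero, add_zero,
    eps_zero, one_smul]
  rfl

theorem φWord_of_two_le (L : List (Letter 𝓑)) (hL : 2 ≤ L.length) :
    R.φWord L = R.H (R.uWord L + R.vWord L) := by
  rw [φWord, uWord, vWord, shiftedEval, shiftedEval, shiftedEval, ← smul_add, map_zsmul]
  exact congrArg _ (φ_apply R _ hL _)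

theorem lWord_of_two_le (L : List (Letter 𝓑)) (hL : 2 ≤ L.length) :
    R.lWord L = R.F (R.vWord L) := by
  rw [lWord, vWord, shiftedEval, shiftedEval, map_zsmul]
  exact congrArg _ (l_apply R _ hL _)

theorem vWord_cons (x : Letter 𝓑) (L : List (Letter 𝓑)) :
    R.vWord (x :: L) = unshuffleSum (koszulFactor Letter.par) L fun A D =>
      eps (x.par + wordParity Letter.par A + 1) •
        Y.bracket (R.φWord (x :: A)) (R.φWord D) := by
  obtain ⟨n, xs, rfl⟩ := exists_ofFn L
  have h := sum_bracketPerm R.φ Y.bracket R.φ_zero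
    (d := fun i => (Fin.cons x xs : Fin (n + 1) → Letter 𝓑) i |>.deg)
    (v := fun i => (Fin.cons x xs : Fin (n + 1) → Letter 𝓑) i |>.val)
    (hv := fun i => (Fin.cons x xs : Fin (n + 1) → Letter 𝓑) i |>.mem)
  have h0 := v_apply R (n + 1) _ _ fun i => (Fin.cons x xs : Fin (n + 1) → Letter 𝓑) i |>.mem
  refine Eq.trans ?_ h
  rw [show x :: List.ofFn xs = List.ofFn (Fin.cons x xs : Fin (n + 1) → Letter 𝓑) by
    simp [List.ofFn_succ], vWord, shiftedEval, evalWord_ofFn, h0]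

theorem uWord_eq (L : List (Letter 𝓑)) :
    R.uWord L = - unshuffleSum (koszulFactor Letter.par) L fun A D =>
      if 2 ≤ A.length then R.φWord (R.lLetter A :: D) else 0 := by
  obtain ⟨n, x, rfl⟩ := exists_ofFn L
  have h := sum_insertPerm R.φ R.l R.hasDegree_l 2 _ _ fun i => (x i).mem
  refine Eq.trans ?_ (congrArg Neg.neg h)
  rw [uWord, shiftedEval, evalWord_ofFn, u_apply R n _ _ fun i => (x i).mem, ← smul_neg,
    ← Finset.sum_neg_distrib]
  congr 1
  refine Finset.sum_congr rfl fun k _ => ?_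
  rw [← Finset.sum_neg_distrib]
  refine Finset.sum_congr rfl fun σ _ => ?_
  rw [Int.negOnePow_succ, neg_mul, Units.neg_smul]
  rfl

theorem bracket_φWord_skew (A D : List (Letter 𝓑)) :
    Y.bracket (R.φWord A) (R.φWord D) =
      - eps ((wordParity Letter.par A + 1) * (wordParity Letter.par D + 1)) •
        Y.bracket (R.φWord D) (R.φWord A) := by
  rw [Y.bracket_skew _ _ _ _ (R.φWord_mem A) (R.φWord_mem D), Units.smul_def, coe_negOnePow,
    Int.cast_mul, coe_shiftedDeg_add_one, coe_shiftedDeg_add_one, neg_smul]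

/-- By cocommutativity and the skew symmetry of the bracket, restricting the sum to the splittings
whose first part contains the first letter amounts to halving it. -/
theorem vWord_add_vWord (L : List (Letter 𝓑)) :
    R.vWord L + R.vWord L = unshuffleSum (koszulFactor Letter.par) L fun A D =>
      eps (wordParity Letter.par A + 1) • Y.bracket (R.φWord A) (R.φWord D) := by
  rcases L with _ | ⟨x, L⟩
  · simp [vWord_nil, φWord_nil]
  · rw [unshuffleSum_cons]
    congr 1
    · simp only [vWord_cons, wordParity_cons]
    · rw [vWord_cons, unshuffleSum_comm]
      refine unshuffleSum_congr _ fun A D _ => ?_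
      rw [bracket_φWord_skew, moveSign_koszulFactor, smul_smul, smul_smul, smul_smul,
        wordParity_cons]
      congr 1
      generalize x.par = a, wordParity _ A = b, wordParity _ D = d
      revert a b d
      decide

/-! ### Graded symmetry -/

/-- The maps `φₙ` and `lₙ` are graded symmetric on words. The induction step passes from `vₙ`
(through its double) to `lₙ = F vₙ`, then to `uₙ`, in which `lₙ` occurs, and to `φₙ`. -/
theorem adjSymmetric_word [CharZero 𝕜] (n : ℕ) :
    AdjSymmetric (koszulFactor (Letter.par (𝓑 := 𝓑))) n R.φWord ∧
      AdjSymmetric (koszulFactor (Letter.par (𝓑 := 𝓑))) n R.lWord := by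
  have : IsAddTorsionFree C := IsAddTorsionFree.of_isTorsionFree 𝕜 C
  induction n using Nat.strong_induction_on with
  | _ n ih =>
    have hswap : ∀ P x y (Q : List (Letter 𝓑)),
        wordParity Letter.par (P ++ x :: y :: Q) = wordParity Letter.par (P ++ y :: x :: Q) :=
      fun P x y Q => wordParity_perm _ ((List.Perm.swap _ _ _).append_left _)
    have hv : AdjSymmetric (koszulFactor (Letter.par (𝓑 := 𝓑))) n R.vWord := by
      have h2 : AdjSymmetric (koszulFactor (Letter.par (𝓑 := 𝓑))) n
          fun L => R.vWord L + R.vWord L := by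
        simp only [vWord_add_vWord]
        refine adjSymmetric_unshuffleSum _ (fun k D hk => ?_) (fun k A hk => ?_)
        · intro P x y Q hl
          simp only
          rcases D with _ | ⟨z, D⟩
          · simp [φWord_nil]
          · rw [(ih k (by simp at hk; omega)).1 P x y Q hl, hswap, bracket_zsmul_left, smul_smul,
              smul_smul, mul_comm]
        · intro P x y Q hl
          simp only
          rcases A with _ | ⟨z, A⟩
          · simp [φWord_nil]
          · rw [(ih k (by simp at hk; omega)).1 P x y Q hl, bracket_zsmul_right, smul_smul,
              smul_smul, mul_comm]
      intro P x y Q hl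
      have h3 := h2 P x y Q hl
      simp only [← two_nsmul] at h3
      rw [smul_comm] at h3
      exact nsmul_right_injective two_ne_zero h3
    have hl : AdjSymmetric (koszulFactor (Letter.par (𝓑 := 𝓑))) n R.lWord := by
      intro P x y Q hn
      rw [lWord_of_two_le _ _ (by simp; omega), lWord_of_two_le _ _ (by simp; omega),
        hv P x y Q hn, map_zsmul]
    have hl' : ∀ k ≤ n, AdjSymmetric (koszulFactor (Letter.par (𝓑 := 𝓑))) k R.lWord := by
      intro k hk
      rcases hk.eq_or_lt with rfl | hk
      · exact hl
      · exact (ih k hk).2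
    have hu : AdjSymmetric (koszulFactor (Letter.par (𝓑 := 𝓑))) n R.uWord := by
      have h2 : AdjSymmetric (koszulFactor (Letter.par (𝓑 := 𝓑))) n fun L =>
          unshuffleSum (koszulFactor Letter.par) L fun A D =>
            if 2 ≤ A.length then R.φWord (R.lLetter A :: D) else 0 := by
        refine adjSymmetric_unshuffleSum _ (fun k D hk => ?_) (fun k A hk => ?_)
        · intro P x y Q hl
          have h2 := hl' k (by omega) P x y Q hl
          rw [lWord, lWord] at h2
          simp only [φWord, lLetter, shiftedEval_insertLetter, hswap P x y Q]
          rw [if_pos (by simp; omega), if_pos (by simp; omega), h2, map_zsmul, smul_comm]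
        · intro P x y Q hl
          simp only
          split_ifs with hA
          · exact ((ih (k + 1) (by omega)).1.cons (R.lLetter A)) P x y Q hl
          · rw [smul_zero]
      intro P x y Q hl
      rw [uWord_eq, uWord_eq, smul_neg, ← h2 P x y Q hl]
    refine ⟨?_, hl⟩
    intro P x y Q hn
    rw [φWord_of_two_le _ _ (by simp; omega), φWord_of_two_le _ _ (by simp; omega),
      hv P x y Q hn, hu P x y Q hn, ← smul_add, map_zsmul]

/-! ### The curvature and the Jacobiator vanish -/

/-- The curvature of `φ`: the left-hand side of the relation of a weak `L∞`-morphism. -/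
noncomputable def curvature (L : List (Letter 𝓑)) : C :=
  Y.d (R.φWord L) -
    unshuffleSum (koszulFactor Letter.par) L (fun A D => R.φWord (R.lLetter A :: D)) + R.vWord L

/-- The left-hand side of the relation of an `L∞`-algebra. -/
noncomputable def jacobiator (L : List (Letter 𝓑)) : B :=
  unshuffleSum (koszulFactor Letter.par) L (fun A D => R.lWord (R.lLetter A :: D))

theorem φWord_lLetter (A D : List (Letter 𝓑)) : R.φWord (R.lLetter A :: D) =
    eps (wordParity Letter.par A * D.length + decalage D) • evalFirst R.φ D (R.lWord A) :=
  shiftedEval_insertLetter _ _ _ _ _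

theorem lWord_eq_zero {x : Letter 𝓑} (hx : x.val = 0) {L : List (Letter 𝓑)} (h : x ∈ L) :
    R.lWord L = 0 := shiftedEval_eq_zero_of_mem _ hx h

theorem φWord_eq_zero {x : Letter 𝓑} (hx : x.val = 0) {L : List (Letter 𝓑)} (h : x ∈ L) :
    R.φWord L = 0 := shiftedEval_eq_zero_of_mem _ hx h

theorem curvature_eq_zero_of_mem {x : Letter 𝓑} (hx : x.val = 0) {L : List (Letter 𝓑)}
    (h : x ∈ L) : R.curvature L = 0 := by
  rw [curvature, R.φWord_eq_zero hx h, map_zero, vWord, shiftedEval_eq_zero_of_mem _ hx h,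
    unshuffleSum_eq_zero, sub_zero, add_zero]
  intro A D hAD
  rcases List.mem_append.1 (hAD.symm.subset h) with hA | hD
  · exact R.φWord_eq_zero (R.lWord_eq_zero hx hA) List.mem_cons_self
  · exact R.φWord_eq_zero hx (List.mem_cons_of_mem _ hD)

/-- The family whose only nonzero member is the differential `l₁`. -/
noncomputable def differential (n : ℕ) : MultilinearMap 𝕜 (fun _ : Fin n => B) B :=
  if n = 1 then R.l n else 0

theorem hasDegree_differential (n : ℕ) : HasDegree 𝓑 𝓑 (R.differential n) (2 - n) := by
  rw [differential]
  split_ifs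
  · exact R.hasDegree_l n
  · exact fun _ _ _ => Submodule.zero_mem _

/-- The differential of a word of length one, as a letter; its underlying element is zero for words
of any other length. -/
noncomputable def dLetter (A : List (Letter 𝓑)) : Letter 𝓑 :=
  insertLetter R.differential R.hasDegree_differential A

theorem dLetter_of_length {A : List (Letter 𝓑)} (hA : A.length = 1) :
    R.dLetter A = R.lLetter A := by
  simp only [dLetter, lLetter, insertLetter, shiftedEval, evalWord, differential, hA, if_true]

theorem dLetter_val_eq_zero {A : List (Letter 𝓑)} (hA : A.length ≠ 1) : (R.dLetter A).val = 0 := by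
  simp only [dLetter, insertLetter, shiftedEval, evalWord, differential, hA, if_false]
  exact smul_zero _

theorem lLetter_nil_val : (R.lLetter ([] : List (Letter 𝓑))).val = 0 := R.lWord_nil

theorem dLetter_dLetter_val (A D : List (Letter 𝓑)) :
    (R.dLetter (R.dLetter A :: D)).val = 0 := by
  rcases D with _ | ⟨y, D⟩
  · rw [R.dLetter_of_length (by simp)]
    change R.lWord _ = 0
    rw [lWord_singleton]
    by_cases hA : A.length = 1
    · obtain ⟨x, rfl⟩ := List.length_eq_one_iff.1 hA
      rw [R.dLetter_of_length hA]
      change X.d (R.lWord _) = 0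
      rw [lWord_singleton, X.d_d]
    · rw [R.dLetter_val_eq_zero hA, map_zero]
  · exact R.dLetter_val_eq_zero (by simp)

/-- The coderivation on words induced by the differential, composed with `g`. -/
noncomputable def precompD {M : Type*} [AddCommGroup M] (g : List (Letter 𝓑) → M)
    (L : List (Letter 𝓑)) : M :=
  unshuffleSum (koszulFactor Letter.par) L fun A D => g (R.dLetter A :: D)

/-- The sum `uₙ + vₙ`, on words. -/
noncomputable def uvWord (L : List (Letter 𝓑)) : C := R.uWord L + R.vWord L

theorem curvature_eq (L : List (Letter 𝓑)) :
    R.curvature L = Y.d (R.φWord L) - R.precompD R.φWord L + R.uvWord L := by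
  have h : unshuffleSum (koszulFactor Letter.par) L (fun A D => R.φWord (R.lLetter A :: D)) =
      R.precompD R.φWord L - R.uWord L := by
    rw [uWord_eq, sub_neg_eq_add, precompD, ← unshuffleSum_add]
    refine unshuffleSum_congr _ fun A D _ => ?_
    rcases A with _ | ⟨x, _ | ⟨y, A⟩⟩
    · rw [R.φWord_eq_zero R.lLetter_nil_val List.mem_cons_self,
        R.φWord_eq_zero (R.dLetter_val_eq_zero (by simp)) List.mem_cons_self]
      simp
    · rw [R.dLetter_of_length (by simp)]
      simp
    · rw [R.φWord_eq_zero (R.dLetter_val_eq_zero (by simp)) List.mem_cons_self]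
      simp
  rw [curvature, h, uvWord]
  abel

theorem uvWord_eq_zero {x : Letter 𝓑} (hx : x.val = 0) {L : List (Letter 𝓑)} (h : x ∈ L) :
    R.uvWord L = 0 := by
  rw [uvWord, uWord, vWord, shiftedEval_eq_zero_of_mem _ hx h, shiftedEval_eq_zero_of_mem _ hx h,
    add_zero]

/-- Since `F G = Id` and `F H = 0`, the map `F` annihilates `uₙ + vₙ` for `n ≥ 2`. -/
theorem F_uvWord (L : List (Letter 𝓑)) (hL : 2 ≤ L.length) : R.F (R.uvWord L) = 0 := by
  have h : R.F (R.uWord L) = - R.lWord L := by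
    rw [uWord_eq, map_neg, linearMap_unshuffleSum, unshuffleSum_eq_left]
    · rw [if_pos hL, φWord_singleton, R.F_G]
      rfl
    · intro A D _ hD
      split_ifs
      · obtain ⟨y, D, rfl⟩ := List.exists_cons_of_ne_nil hD
        rw [φWord_of_two_le _ _ (by simp), R.F_H]
      · rw [map_zero]
  rw [uvWord, map_add, h, R.lWord_of_two_le L hL, neg_add_cancel]

/-- Two insertions of the differential of `B` into `φ` cancel. -/
theorem precompD_precompD_φWord [CharZero 𝕜] (L : List (Letter 𝓑)) :
    R.precompD (R.precompD R.φWord) L = 0 := by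
  have : IsAddTorsionFree C := IsAddTorsionFree.of_isTorsionFree 𝕜 C
  refine (unshuffleSum_insert_insert Letter.par R.φWord R.dLetter
    (insertLetter_par _ _) L fun A D V _ => ?_).trans ?_
  · have h := (R.adjSymmetric_word _).1 [] (R.dLetter A) (R.dLetter D) V rfl
    rw [koszulFactor, dLetter, dLetter, insertLetter_par, insertLetter_par] at h
    exact h
  · refine unshuffleSum_eq_zero _ fun A D _ => unshuffleSum_eq_zero _ fun U V _ => ?_
    exact R.φWord_eq_zero (R.dLetter_dLetter_val U V) List.mem_cons_self

/-- The Bianchi identity, with the double insertions of `lₙ` collected into Jacobiators. -/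
theorem bianchi_curvature [CharZero 𝕜] (L : List (Letter 𝓑)) :
    Y.d (R.curvature L)
      + unshuffleSum (koszulFactor Letter.par) L (fun A D => R.curvature (R.lLetter A :: D))
      + unshuffleSum (koszulFactor Letter.par) L (fun A D =>
        eps ((wordParity Letter.par A + 1) * D.length + decalage D) •
          evalFirst R.φ D (R.jacobiator A))
      = unshuffleSum (koszulFactor Letter.par) L (fun A D =>
        eps (wordParity Letter.par A + 1) • Y.bracket (R.curvature A) (R.φWord D)) := by
  have : IsAddTorsionFree C := IsAddTorsionFree.of_isTorsionFree 𝕜 C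
  rw [← bianchi Letter.par Y.d Y.bracket R.φWord R.vWord R.lLetter R.curvature R.lLetter_par Y.d_d
    ?_ ?_ ?_ R.vWord_add_vWord R.vWord_cons (fun _ => rfl) L ?_]
  · congr 1
    refine unshuffleSum_congr _ fun A D _ => ?_
    rw [jacobiator, linearMap_unshuffleSum, ← unshuffleSum_smul]
    refine unshuffleSum_congr _ fun U V h => ?_
    rw [φWord_lLetter, wordParity_cons, lLetter_par, wordParity_split _ h, add_right_comm]
  · intro A D
    rw [Y.bracket_skew _ _ _ _ (R.φWord_mem A) (Y.d_mem _ _ (R.φWord_mem D)), Units.smul_def,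
      coe_negOnePow, Int.cast_mul, Int.cast_add (_ + 1), coe_shiftedDeg_add_one,
      coe_shiftedDeg_add_one, neg_smul, Int.cast_one, add_assoc (wordParity _ D),
      one_add_one_eq_two, two_eq_zero, add_zero]
  · intro A D
    rw [Y.leibniz _ _ _ _ (R.φWord_mem A) (R.φWord_mem D), Units.smul_def, coe_negOnePow,
      coe_shiftedDeg_add_one]
  · intro A D V
    have h := Y.jacobi _ _ _ _ _ _ (R.φWord_mem A) (R.φWord_mem D) (R.φWord_mem V)
    simp only [Units.smul_def, coe_negOnePow, Int.cast_mul] at h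
    rw [Int.cast_add (shiftedDeg D + 1)] at h
    simp only [coe_shiftedDeg_add_one] at h
    rw [← h, add_add_add_comm (wordParity _ D), one_add_one_eq_two, two_eq_zero, add_zero]
  · intro A D V _
    have h := (R.adjSymmetric_word _).1 [] (R.lLetter A) (R.lLetter D) V rfl
    rw [koszulFactor, lLetter_par, lLetter_par] at h
    exact h

/-- The relations of the `L∞`-algebra and of the weak `L∞`-morphism, on words. -/
theorem curvature_jacobiator_eq_zero [CharZero 𝕜] (n : ℕ) : ∀ L : List (Letter 𝓑), L.length = n →
    R.curvature L = 0 ∧ R.jacobiator L = 0 := by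
  induction n using Nat.strong_induction_on with
  | _ n ih =>
    intro L hL
    rcases L with _ | ⟨x, _ | ⟨y, L⟩⟩
    · constructor
      · rw [curvature, φWord_nil, vWord_nil, unshuffleSum_nil,
          R.φWord_eq_zero R.lLetter_nil_val List.mem_cons_self]
        simp
      · rw [jacobiator, unshuffleSum_nil,
          R.lWord_eq_zero R.lLetter_nil_val List.mem_cons_self]
    · have hl : (R.lLetter [x]).val = X.d x.val := R.lWord_singleton x
      constructor
      · rw [curvature, φWord_singleton, vWord_cons, unshuffleSum_cons, unshuffleSum_nil,
          unshuffleSum_nil, unshuffleSum_nil,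
          R.φWord_eq_zero R.lLetter_nil_val List.mem_cons_self, φWord_nil, φWord_singleton, hl,
          R.G_comm]
        simp
      · rw [jacobiator, unshuffleSum_cons, unshuffleSum_nil, unshuffleSum_nil,
          R.lWord_eq_zero R.lLetter_nil_val List.mem_cons_self, lWord_singleton, hl, X.d_d]
        simp
    · set K := x :: y :: L with hK
      have hK2 : 2 ≤ K.length := by simp [hK]
      have hb := R.bianchi_curvature K
      -- the bracket terms contain the curvature of shorter words only
      rw [unshuffleSum_eq_zero (f := fun A D =>
        eps (wordParity Letter.par A + 1) • Y.bracket (R.curvature A) (R.φWord D))] at hb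
      swap
      · intro A D hAD
        rcases D with _ | ⟨z, D⟩
        · simp [φWord_nil]
        · have h := hAD.length_eq
          simp only [List.length_append, List.length_cons] at h
          rw [(ih A.length (by omega) A rfl).1, map_zero, LinearMap.zero_apply, smul_zero]
      -- of the Jacobiators, only the one of the whole word is left
      rw [unshuffleSum_eq_left (f := fun A D =>
        eps ((wordParity Letter.par A + 1) * D.length + decalage D) •
          evalFirst R.φ D (R.jacobiator A))] at hb
      swap
      · intro A D hAD hD
        obtain ⟨z, D, rfl⟩ := List.exists_cons_of_ne_nil hD
        have h := hAD.length_eq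
        simp only [List.length_append, List.length_cons] at h
        rw [(ih A.length (by omega) A rfl).2, map_zero, smul_zero]
      have hG : evalFirst R.φ ([] : List (Letter 𝓑)) (R.jacobiator K) = R.G (R.jacobiator K) := by
        rw [← φ_one]
        refine congrArg (R.φ 1) (funext fun i => ?_)
        exact Fin.cases rfl (fun j => j.elim0) i
      rw [hG] at hb
      simp only [List.length_nil, Nat.cast_zero, mul_zero, decalage_nil, add_zero, eps_zero,
        one_smul] at hb
      -- in the insertions into the curvature, only the differential of `B` is left
      have hins : unshuffleSum (koszulFactor Letter.par) K
          (fun A D => R.curvature (R.lLetter A :: D)) = R.precompD R.curvature K := by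
        refine unshuffleSum_congr _ fun A D hAD => ?_
        by_cases hA : A.length = 1
        · rw [R.dLetter_of_length hA]
        · rw [R.curvature_eq_zero_of_mem (R.dLetter_val_eq_zero hA) List.mem_cons_self]
          rcases A with _ | ⟨a, _ | ⟨b, A⟩⟩
          · exact R.curvature_eq_zero_of_mem R.lLetter_nil_val List.mem_cons_self
          · simp at hA
          · have h := hAD.length_eq
            simp only [List.length_append, List.length_cons] at h
            exact (ih (D.length + 1) (by omega) _ rfl).1
      have hpre : R.precompD R.curvature K =
          Y.d (R.precompD R.φWord K) + R.precompD R.uvWord K := by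
        have h : R.precompD R.curvature K = Y.d (R.precompD R.φWord K) -
            R.precompD (R.precompD R.φWord) K + R.precompD R.uvWord K := by
          simp only [precompD, linearMap_unshuffleSum, ← unshuffleSum_sub, ← unshuffleSum_add]
          exact unshuffleSum_congr _ fun A D _ => R.curvature_eq _
        rw [h, precompD_precompD_φWord, sub_zero]
      have hw : Y.d (R.uvWord K) + R.precompD R.uvWord K + R.G (R.jacobiator K) = 0 := by
        rw [← hb, hins, hpre, curvature_eq, map_add, map_sub, Y.d_d]
        abel
      have hlen : ∀ A D : List (Letter 𝓑), (A ++ D).Perm K → A.length = 1 →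
          2 ≤ (R.dLetter A :: D).length := by
        intro A D hAD hA
        have h := hAD.length_eq
        simp only [List.length_append, List.length_cons] at h ⊢
        omega
      -- apply `F`, which annihilates `uₙ + vₙ`
      have hJ : R.jacobiator K = 0 := by
        have h := congrArg R.F hw
        rw [map_add, map_add, ← R.F_comm, F_uvWord _ _ hK2, map_zero, map_zero, zero_add, R.F_G,
          precompD, linearMap_unshuffleSum, unshuffleSum_eq_zero, zero_add] at h
        · exact h
        · intro A D hAD
          by_cases hA : A.length = 1
          · exact R.F_uvWord _ (hlen A D hAD hA)
          · rw [R.uvWord_eq_zero (R.dLetter_val_eq_zero hA) List.mem_cons_self, map_zero]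
      refine ⟨?_, hJ⟩
      have hφ : R.precompD R.φWord K = R.H (R.precompD R.uvWord K) := by
        rw [precompD, precompD, linearMap_unshuffleSum]
        refine unshuffleSum_congr _ fun A D hAD => ?_
        by_cases hA : A.length = 1
        · exact R.φWord_of_two_le _ (hlen A D hAD hA)
        · rw [R.uvWord_eq_zero (R.dLetter_val_eq_zero hA) List.mem_cons_self, map_zero,
            R.φWord_eq_zero (R.dLetter_val_eq_zero hA) List.mem_cons_self]
      have hH := R.homotopy (R.uvWord K)
      rw [F_uvWord _ _ hK2, map_zero, zero_sub] at hH
      rw [hJ, map_zero, add_zero] at hw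
      have h2 := congrArg R.H hw
      rw [map_add, map_zero] at h2
      rw [curvature_eq, hφ, R.φWord_of_two_le K hK2]
      change Y.d (R.H (R.uvWord K)) - _ + _ = 0
      linear_combination (norm := abel) -hH - h2

theorem isLInfinityAlgebra [CharZero 𝕜] : IsLInfinityAlgebra 𝓑 R.l where
  degree n _ := R.hasDegree_l n
  skew n _ := isSkew_of_adjSymmetric R.l (R.adjSymmetric_word n).2
  relation n _ d v hv := by
    have h := sum_insertPerm R.l R.l R.hasDegree_l 1 d v hv
    rw [unshuffleSum_congr _ (g := fun A D => R.lWord (R.lLetter A :: D)) fun A D _ => by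
      split_ifs with hA
      · rfl
      · obtain rfl : A = [] := List.length_eq_zero_iff.1 (by omega)
        exact (R.lWord_eq_zero R.lLetter_nil_val List.mem_cons_self).symm] at h
    exact eq_zero_of_eps_smul (h.trans (R.curvature_jacobiator_eq_zero _ _ rfl).2)

theorem isWeakLInfinityMorphism [CharZero 𝕜] : IsWeakLInfinityMorphism 𝓑 R.l Y R.φ where
  degree n _ := R.hasDegree_φ n
  skew n _ := isSkew_of_adjSymmetric R.φ (R.adjSymmetric_word n).1
  relation n _ d v hv := by
    have h := sum_insertPerm R.φ R.l R.hasDegree_l 1 d v hv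
    rw [unshuffleSum_congr _ (g := fun A D => R.φWord (R.lLetter A :: D)) fun A D _ => by
      split_ifs with hA
      · rfl
      · obtain rfl : A = [] := List.length_eq_zero_iff.1 (by omega)
        exact (R.φWord_eq_zero R.lLetter_nil_val List.mem_cons_self).symm] at h
    have h0 := (R.curvature_jacobiator_eq_zero _
      (List.ofFn fun i => (⟨d i, v i, hv i⟩ : Letter 𝓑)) rfl).1
    rw [curvature, ← h, φWord, vWord, shiftedEval, shiftedEval, evalWord_ofFn, evalWord_ofFn,
      map_zsmul, ← smul_sub, ← smul_add] at h0
    have h1 := eq_zero_of_eps_smul h0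
    rw [v_apply R n d v hv, sub_eq_add_neg, ← Finset.sum_neg_distrib] at h1
    refine Eq.trans ?_ h1
    refine congrArg₂ _ (congrArg₂ _ rfl (Finset.sum_congr rfl fun k _ => ?_)) rfl
    rw [← Finset.sum_neg_distrib]
    refine Finset.sum_congr rfl fun σ _ => ?_
    rw [Int.negOnePow_succ, mul_neg, Units.neg_smul, mul_comm]

end Contraction

end LInfTransfer

open LInfTransfer in
theorem theorem2p2 {𝕜 B C : Type*} [Field 𝕜] [CharZero 𝕜]
    [AddCommGroup B] [Module 𝕜 B] [AddCommGroup C] [Module 𝕜 C]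
    (𝓑 : ℤ → Submodule 𝕜 B) [DirectSum.Decomposition 𝓑]
    (𝓒 : ℤ → Submodule 𝕜 C) [DirectSum.Decomposition 𝓒]
    (X : CochainStructure 𝓑) (Y : DGLieStructure 𝓒)
    (R : Contraction X Y.toCochainStructure) :
    IsLInfinityAlgebra 𝓑 R.l ∧ (∀ x : B, R.l 1 ![x] = X.d x) ∧
      IsWeakLInfinityMorphism 𝓑 R.l Y R.φ ∧ (∀ x : B, R.φ 1 ![x] = R.G x) :=
  ⟨R.isLInfinityAlgebra, R.l_one, R.isWeakLInfinityMorphism, R.φ_one⟩
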